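/- Let $G$ be a finite group, $m\in\mathbb Z$ and $d\ge 1$ an integer, $\zeta_d=e^{2\pi i/d}$. For $z\in G$ let $C_G(z)$ be its centralizer, and for a finite group $H$ let $\mathrm{Irr}(H)$ be the set of its irreducible complex characters. Let $\gamma_m^z\colon C_G(z)\to\mathbb C$ be the class function $$\gamma_m^z(g)=\bigl|\{x\in G : x^m=(gx)^m=z\}\bigr| ,$$ and let $\beta_m(z,\chi)\in\mathbb C$, for $\chi\in\mathrm{Irr}(C_G(z))$, be the unique coefficients with $\gamma_m^z=\sum_{\chi\in\mathrm{Irr}(C_G(z))}\beta_m(z,\chi)\,\chi$; explicitly, $\beta_m(z,\chi)=\frac1{|C_G(z)|}\sum_{g\in C_G(z)}\gamma_m^z(g)\overline{\chi(g)}$. Let $D(G)$ be the Drinfeld double of the Hopf algebra $\mathbb C[G]$: it has the basis $\delta_h x$ $(h,x\in G)$, with $$(\delta_h x)(\delta_k y)=[h=xkx^{-1}]\,\delta_h\,xy,\quad \Delta(\delta_h x)=\sum_{ab=h}\delta_b x\otimes\delta_a x,\quad \varepsilon(\delta_h x)=[h=1],\quad S(\delta_h x)=\delta_{x^{-1}h^{-1}x}\,x^{-1},$$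 and the normalized integral $\Lambda=\frac1{|G|}\sum_{x\in G}\delta_1x$. The $m$-th Frobenius–Schur indicator of a finite-dimensional $D(G)$-module $V$ is $\nu_m(V)=\operatorname{tr}_V(\Lambda^{[m]})$, where $\Lambda^{[m]}$ is the $m$-th Sweedler power, that is, the value at $\Lambda$ of the $m$-th power of the identity map under convolution (the convolution inverse of the identity being the antipode $S$). For $g\in G$ and $\eta\in\mathrm{Irr}(C_G(g))$ afforded by a representation $\rho$ on $W$, the $D(G)$-module associated with $(g,\eta)$ is the space of all $f\colon G\to W$ with $f(xc)=\rho(c)^{-1}f(x)$ for $x\in G$, $c\in C_G(g)$, on which $\delta_h t$ sends $f$ to $x\mapsto [h=xgx^{-1}]\,f(t^{-1}x)$; let $\nu_m(g,\eta)$ be its $m$-th indicator. Then $\nu_m(g,\eta)\in\mathbb Q(\zeta_d)$ for all $g\in G$ and $\eta\in\mathrm{Irr}(C_G(g))$ if and only if $\beta_m(z,\chi)\in\mathbb Q(\zeta_d)$ for all $z\in G$ and $\chi\in\mathrm{Irr}(C_G(z))$. Likewise, $\nu_m(V)\in\mathbb Q(\zeta_d)$ for all simple $D(G)$-modules $V$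 if and only if $\beta_m(z,\chi)\in\mathbb Q(\zeta_d)$ for all $z\in G$ and $\chi\in\mathrm{Irr}(C_G(z))$. -/

import Mathlib

universe u

open scoped TensorProduct

/-- The underlying vector space of the Drinfeld double of the complex group algebra of `G`:
the free complex vector space on the pairs `(h, x)`, where `(h, x)` stands for the basis element
`δ_h x`, the product of the indicator function `δ_h ∈ ℂ^G` and the group element `x ∈ ℂ[G]`. -/
def DrinfeldDouble (G : Type u) : Type u := G × G →₀ ℂ

namespace DrinfeldDouble

noncomputable section

section Basis

variable {G : Type u}

instance : AddCommGroup (DrinfeldDouble G) := inferInstanceAs (AddCommGroup (G × G →₀ ℂ))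

instance : Module ℂ (DrinfeldDouble G) := inferInstanceAs (Module ℂ (G × G →₀ ℂ))

/-- The basis element `δ_h x`. -/
def e (h x : G) : DrinfeldDouble G := Finsupp.single (h, x) (1 : ℂ)

/-- The linear map with prescribed values on the basis elements `δ_h x`. -/
def lift {M : Type*} [AddCommGroup M] [Module ℂ M] (f : G → G → M) :
    DrinfeldDouble G →ₗ[ℂ] M :=
  Finsupp.linearCombination ℂ (fun p : G × G => f p.1 p.2)

theorem lift_e {M : Type*} [AddCommGroup M] [Module ℂ M] (f : G → G → M) (h x : G) :
    lift f (e h x) = f h x := by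
  unfold lift e
  exact (Finsupp.linearCombination_single ℂ (1 : ℂ) (h, x)).trans (one_smul ℂ _)

theorem hom_ext {M : Type*} [AddCommGroup M] [Module ℂ M] {f f' : DrinfeldDouble G →ₗ[ℂ] M}
    (H : ∀ h x, f (e h x) = f' (e h x)) : f = f' :=
  Finsupp.lhom_ext' fun p => LinearMap.ext_ring (H p.1 p.2)

end Basis

variable {G : Type u} [Group G]

open scoped Classical in
/-- The multiplication `(δ_h x) (δ_k y) = [h = x k x⁻¹] δ_h (x y)`, extended bilinearly. -/
def mulHom : DrinfeldDouble G →ₗ[ℂ] DrinfeldDouble G →ₗ[ℂ] DrinfeldDouble G :=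
  lift fun h x => lift fun k y => if h = x * k * x⁻¹ then e h (x * y) else 0

instance : Mul (DrinfeldDouble G) := ⟨fun a b => mulHom a b⟩

theorem mul_def (a b : DrinfeldDouble G) : a * b = mulHom a b := rfl

open scoped Classical in
theorem e_mul_e (h x k y : G) :
    e h x * e k y = if h = x * k * x⁻¹ then e h (x * y) else 0 := by
  rw [mul_def, mulHom, lift_e, lift_e]

theorem mulHom_assoc (a b c : DrinfeldDouble G) :
    mulHom (mulHom a b) c = mulHom a (mulHom b c) := by
  classical
  have key : (mulHom (G := G)).compr₂ mulHom
      = ((LinearMap.llcomp ℂ (DrinfeldDouble G) (DrinfeldDouble G) (DrinfeldDouble G)).flip.comp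
          mulHom).flip.comp mulHom := by
    refine hom_ext fun h x => hom_ext fun k y => hom_ext fun l w => ?_
    change mulHom (mulHom (e h x) (e k y)) (e l w) = mulHom (e h x) (mulHom (e k y) (e l w))
    simp only [← mul_def, e_mul_e]
    by_cases h1 : h = x * k * x⁻¹ <;> by_cases h2 : k = y * l * y⁻¹
    · rw [if_pos h1, if_pos h2, e_mul_e, e_mul_e, if_pos h1, if_pos, mul_assoc]
      rw [h1, h2]; group
    · rw [if_pos h1, if_neg h2, e_mul_e, if_neg, mul_def, map_zero]
      rintro h3
      refine h2 ?_
      have h4 : k = x⁻¹ * h * x := by rw [h1]; group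
      rw [h4, h3]; group
    · rw [if_neg h1, if_pos h2, e_mul_e, if_neg h1, mul_def, map_zero, LinearMap.zero_apply]
    · rw [if_neg h1, if_neg h2, mul_def, mul_def, map_zero, map_zero, LinearMap.zero_apply]
  exact congrArg (fun f => f a b c) key

variable [Fintype G]

/-- The unit is `∑_g δ_g 1`. -/
instance : One (DrinfeldDouble G) := ⟨∑ g : G, e g 1⟩

theorem one_def : (1 : DrinfeldDouble G) = ∑ g : G, e g 1 := rfl

theorem mulHom_one_left : (mulHom 1 : DrinfeldDouble G →ₗ[ℂ] DrinfeldDouble G) = .id := by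
  classical
  refine hom_ext fun h x => ?_
  rw [one_def, map_sum, LinearMap.sum_apply]
  simp only [← mul_def, e_mul_e, LinearMap.id_apply]
  simp

theorem mulHom_one_right :
    (mulHom.flip 1 : DrinfeldDouble G →ₗ[ℂ] DrinfeldDouble G) = .id := by
  classical
  refine hom_ext fun h x => ?_
  rw [one_def, LinearMap.flip_apply, map_sum]
  simp only [← mul_def, e_mul_e, LinearMap.id_apply]
  rw [Finset.sum_eq_single (x⁻¹ * h * x)]
  · simp [mul_assoc]
  · intro b _ hb
    rw [if_neg]
    rintro rfl
    exact hb (by group)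
  · simp

instance : Ring (DrinfeldDouble G) :=
  { (inferInstance : AddCommGroup (DrinfeldDouble G)),
    (inferInstance : Mul (DrinfeldDouble G)),
    (inferInstance : One (DrinfeldDouble G)) with
    left_distrib := fun a b c => map_add (mulHom a) b c
    right_distrib := fun a b c => by simp only [mul_def, map_add, LinearMap.add_apply]
    zero_mul := fun a => by simp only [mul_def, map_zero, LinearMap.zero_apply]
    mul_zero := fun a => map_zero (mulHom a)
    mul_assoc := mulHom_assoc
    one_mul := fun a => LinearMap.congr_fun mulHom_one_left a
    mul_one := fun a => LinearMap.congr_fun mulHom_one_right a }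

instance : Algebra ℂ (DrinfeldDouble G) :=
  Algebra.ofModule
    (fun r a b => by simp only [mul_def, map_smul, LinearMap.smul_apply])
    (fun r a b => by simp only [mul_def, map_smul])

/-- The comultiplication is `Δ(δ_h x) = ∑_{ab = h} δ_b x ⊗ δ_a x`, the counit is
`ε(δ_h x) = [h = 1]`. -/
instance : CoalgebraStruct ℂ (DrinfeldDouble G) where
  comul := lift fun h x => ∑ b : G, e b x ⊗ₜ[ℂ] e (h * b⁻¹) x
  counit := by
    classical
    exact lift fun h _ => if h = 1 then 1 else 0

theorem comul_e (h x : G) :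
    CoalgebraStruct.comul (R := ℂ) (e h x) = ∑ b : G, e b x ⊗ₜ[ℂ] e (h * b⁻¹) x :=
  lift_e _ h x

open scoped Classical in
theorem counit_e (h x : G) :
    CoalgebraStruct.counit (R := ℂ) (e h x) = if h = 1 then (1 : ℂ) else 0 :=
  lift_e _ h x

instance : Coalgebra ℂ (DrinfeldDouble G) where
  coassoc := by
    refine hom_ext fun h x => ?_
    simp only [LinearMap.comp_apply, comul_e, map_sum, LinearMap.rTensor_tmul,
      LinearMap.lTensor_tmul, TensorProduct.sum_tmul, TensorProduct.tmul_sum,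
      LinearEquiv.coe_coe, TensorProduct.assoc_tmul]
    rw [Finset.sum_comm]
    refine Finset.sum_congr rfl fun c _ => ?_
    refine Fintype.sum_equiv (Equiv.mulRight c⁻¹) _ _ fun b => ?_
    simp [mul_assoc]
  rTensor_counit_comp_comul := by
    classical
    refine hom_ext fun h x => ?_
    simp only [LinearMap.comp_apply, comul_e, map_sum, LinearMap.rTensor_tmul, counit_e]
    rw [Finset.sum_eq_single 1]
    · simp
    · intro b _ hb; simp [hb]
    · simp
  lTensor_counit_comp_comul := by
    classical
    refine hom_ext fun h x => ?_
    simp only [LinearMap.comp_apply, comul_e, map_sum, LinearMap.lTensor_tmul, counit_e]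
    rw [Finset.sum_eq_single h]
    · simp
    · intro b _ hb
      rw [if_neg, TensorProduct.tmul_zero]
      rw [mul_inv_eq_one]
      exact fun hh => hb hh.symm
    · simp

theorem counit_mul' (a b : DrinfeldDouble G) :
    CoalgebraStruct.counit (R := ℂ) (a * b)
      = CoalgebraStruct.counit (R := ℂ) a * CoalgebraStruct.counit (R := ℂ) b := by
  classical
  have key : (mulHom (G := G)).compr₂ (CoalgebraStruct.counit (R := ℂ))
      = (LinearMap.mul ℂ ℂ).compl₁₂ (CoalgebraStruct.counit (R := ℂ))
          (CoalgebraStruct.counit (R := ℂ)) := by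
    refine hom_ext fun h x => hom_ext fun k y => ?_
    change CoalgebraStruct.counit (R := ℂ) (e h x * e k y)
      = CoalgebraStruct.counit (R := ℂ) (e h x) * CoalgebraStruct.counit (R := ℂ) (e k y)
    rw [e_mul_e, counit_e, counit_e]
    by_cases h1 : k = 1
    · subst h1
      by_cases h2 : h = 1 <;> simp [h2, counit_e]
    · by_cases h2 : h = x * k * x⁻¹
      · simp [h2, h1, counit_e]
      · simp [h2, h1]
  exact congrArg (fun f => f a b) key

theorem comul_mul' (a b : DrinfeldDouble G) :
    CoalgebraStruct.comul (R := ℂ) (a * b)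
      = CoalgebraStruct.comul (R := ℂ) a * CoalgebraStruct.comul (R := ℂ) b := by
  classical
  have key : (mulHom (G := G)).compr₂ (CoalgebraStruct.comul (R := ℂ))
      = (LinearMap.mul ℂ (DrinfeldDouble G ⊗[ℂ] DrinfeldDouble G)).compl₁₂
          (CoalgebraStruct.comul (R := ℂ)) (CoalgebraStruct.comul (R := ℂ)) := by
    refine hom_ext fun h x => hom_ext fun k y => ?_
    change CoalgebraStruct.comul (R := ℂ) (e h x * e k y)
      = CoalgebraStruct.comul (R := ℂ) (e h x) * CoalgebraStruct.comul (R := ℂ) (e k y)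
    rw [e_mul_e, comul_e, comul_e, Finset.sum_mul_sum, Finset.sum_comm]
    have h0 : ∀ c b : G, (e b x ⊗ₜ[ℂ] e (h * b⁻¹) x) * (e c y ⊗ₜ[ℂ] e (k * c⁻¹) y)
        = if b = x * c * x⁻¹ then
            (if h = x * k * x⁻¹ then e b (x * y) ⊗ₜ[ℂ] e (h * b⁻¹) (x * y) else 0) else 0 := by
      intro c b
      rw [Algebra.TensorProduct.tmul_mul_tmul, e_mul_e, e_mul_e]
      by_cases h1 : b = x * c * x⁻¹
      · have h2 : (h * b⁻¹ = x * (k * c⁻¹) * x⁻¹) ↔ h = x * k * x⁻¹ := by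
          rw [mul_inv_eq_iff_eq_mul, h1]
          have : x * (k * c⁻¹) * x⁻¹ * (x * c * x⁻¹) = x * k * x⁻¹ := by group
          rw [this]
        simp only [h2, if_pos h1]
        split_ifs <;> simp
      · simp [h1]
    simp only [h0, Finset.sum_ite_eq', Finset.mem_univ, if_true]
    split_ifs with h1
    · rw [comul_e]
      exact (Fintype.sum_equiv (MulAut.conj x).toEquiv _ _ fun c => rfl).symm
    · simp
  exact congrArg (fun f => f a b) key

instance : Bialgebra ℂ (DrinfeldDouble G) :=
  Bialgebra.mk' ℂ (DrinfeldDouble G)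
    (by
      classical
      rw [one_def, map_sum]
      simp [counit_e])
    (fun {a b} => counit_mul' a b)
    (by
      rw [Algebra.TensorProduct.one_def, one_def, map_sum]
      simp only [comul_e, TensorProduct.sum_tmul, TensorProduct.tmul_sum]
      rw [Finset.sum_comm]
      conv_rhs => rw [Finset.sum_comm]
      refine Finset.sum_congr rfl fun b _ => ?_
      exact Fintype.sum_equiv (Equiv.mulRight b⁻¹) _ _ fun _ => rfl)
    (fun {a b} => comul_mul' a b)

/-- The antipode is `S(δ_h x) = δ_{x⁻¹ h⁻¹ x} x⁻¹`. -/
instance : HopfAlgebra ℂ (DrinfeldDouble G) where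
  antipode := lift fun h x => e (x⁻¹ * h⁻¹ * x) x⁻¹
  mul_antipode_rTensor_comul := by
    classical
    refine hom_ext fun h x => ?_
    simp only [LinearMap.comp_apply, comul_e, map_sum, LinearMap.rTensor_tmul, lift_e,
      LinearMap.mul'_apply, e_mul_e, counit_e, Algebra.linearMap_apply]
    have h0 : ∀ b : G, (x⁻¹ * b⁻¹ * x = x⁻¹ * (h * b⁻¹) * x⁻¹⁻¹) ↔ h = 1 := by
      intro b
      simp
    simp only [h0]
    split_ifs with h1
    · rw [map_one, one_def]
      refine Fintype.sum_equiv ((Equiv.inv G).trans (MulAut.conj x⁻¹).toEquiv) _ _ fun b => ?_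
      simp
    · simp
  mul_antipode_lTensor_comul := by
    classical
    refine hom_ext fun h x => ?_
    simp only [LinearMap.comp_apply, comul_e, map_sum, LinearMap.lTensor_tmul, lift_e,
      LinearMap.mul'_apply, e_mul_e, counit_e, Algebra.linearMap_apply]
    have h0 : ∀ b : G, (b = x * (x⁻¹ * (h * b⁻¹)⁻¹ * x) * x⁻¹) ↔ h = 1 := by
      intro b
      have : x * (x⁻¹ * (h * b⁻¹)⁻¹ * x) * x⁻¹ = b * h⁻¹ := by group
      rw [this]
      simp
    simp only [h0]
    split_ifs with h1
    · rw [map_one, one_def]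
      simp
    · simp

/-- The normalized two-sided integral `Λ = |G|⁻¹ ∑_x δ_1 x` of the Drinfeld double. -/
def integral (G : Type u) [Group G] [Fintype G] : DrinfeldDouble G :=
  (Fintype.card G : ℂ)⁻¹ • ∑ x : G, e 1 x

theorem counit_integral : Coalgebra.counit (R := ℂ) (integral G) = 1 := by
  classical
  have : (Fintype.card G : ℂ) ≠ 0 := Nat.cast_ne_zero.mpr Fintype.card_ne_zero
  rw [integral, map_smul, map_sum]
  simp [counit_e, this]

theorem mul_integral (a : DrinfeldDouble G) :
    a * integral G = Coalgebra.counit (R := ℂ) a • integral G := by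
  classical
  have key : mulHom.flip (integral G)
      = (Coalgebra.counit (R := ℂ)).smulRight (integral G) := by
    refine hom_ext fun h x => ?_
    change e h x * integral G = Coalgebra.counit (R := ℂ) (e h x) • integral G
    rw [counit_e, integral, mul_smul_comm, Finset.mul_sum]
    simp only [e_mul_e, mul_one, mul_inv_cancel]
    split_ifs with h1
    · rw [one_smul, h1]
      congr 1
      exact Fintype.sum_equiv (Equiv.mulLeft x) _ _ fun _ => rfl
    · simp
  exact LinearMap.congr_fun key a

theorem integral_mul (a : DrinfeldDouble G) :
    integral G * a = Coalgebra.counit (R := ℂ) a • integral G := by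
  classical
  have key : mulHom (integral G)
      = (Coalgebra.counit (R := ℂ)).smulRight (integral G) := by
    refine hom_ext fun h x => ?_
    change integral G * e h x = Coalgebra.counit (R := ℂ) (e h x) • integral G
    rw [counit_e, integral, smul_mul_assoc, Finset.sum_mul]
    have h0 : ∀ y : G, ((1 : G) = y * h * y⁻¹) ↔ h = 1 := by
      intro y
      rw [eq_comm, conj_eq_one_iff]
    simp only [e_mul_e, h0]
    split_ifs with h1
    · rw [one_smul]
      congr 1
      exact Fintype.sum_equiv (Equiv.mulRight x) _ _ fun _ => rfl
    · simp
  exact LinearMap.congr_fun key a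

end

end DrinfeldDouble

/-- The `m`-th Sweedler power of `h`: the value at `h` of the `m`-th convolution power of the
identity map, so `h₍₁₎ h₍₂₎ ⋯ h₍ₘ₎` for `m ≥ 1` and `ε(h) 1` for `m = 0`; the convolution inverse
of the identity is the antipode, whose powers give the Sweedler powers for negative `m`. -/
noncomputable def sweedlerPower {H : Type*} [Ring H] [HopfAlgebra ℂ H] : ℤ → H → H
  | Int.ofNat n, h => (WithConv.toConv (LinearMap.id : H →ₗ[ℂ] H) ^ n) h
  | Int.negSucc n, h => (WithConv.toConv (HopfAlgebra.antipode ℂ (A := H)) ^ (n + 1)) h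

/-- The `m`-th Frobenius-Schur indicator of a (finite-dimensional) module `V` over the Drinfeld
double: the value of the character of `V` on the `m`-th Sweedler power of the normalized
integral. -/
noncomputable def fsIndicator (G : Type u) [Group G] [Fintype G] (m : ℤ)
    (V : Type*) [AddCommGroup V] [Module ℂ V] [Module (DrinfeldDouble G) V]
    [IsScalarTower ℂ (DrinfeldDouble G) V] : ℂ :=
  LinearMap.trace ℂ V
    (Algebra.lsmul ℂ ℂ V (sweedlerPower m (DrinfeldDouble.integral G)))

section AssociatedModule

variable {G : Type u} [Group G]

/-- The space of all `f : G → W` with `f (x c) = ρ(c)⁻¹ f(x)` for `c ∈ C_G(g)`, that is, the space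
of the representation of `G` induced from the representation `ρ` of `C_G(g)`. -/
def associatedSubmodule (g : G) {W : Type*} [AddCommGroup W] [Module ℂ W]
    (ρ : Representation ℂ (Subgroup.centralizer ({g} : Set G)) W) : Submodule ℂ (G → W) where
  carrier := {f | ∀ (x : G) (c : Subgroup.centralizer ({g} : Set G)),
    f (x * (c : G)) = ρ c⁻¹ (f x)}
  add_mem' := by
    intro a b ha hb x c
    rw [Pi.add_apply, Pi.add_apply, ha, hb, map_add]
  zero_mem' := by
    intro x c
    simp
  smul_mem' := by
    intro r a ha x c
    rw [Pi.smul_apply, Pi.smul_apply, ha, map_smul]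

/-- The `D(G)`-module associated to `g ∈ G` and a representation `ρ` of `C_G(g)`. -/
def AssociatedModule (g : G) {W : Type*} [AddCommGroup W] [Module ℂ W]
    (ρ : Representation ℂ (Subgroup.centralizer ({g} : Set G)) W) : Type _ :=
  associatedSubmodule g ρ

namespace AssociatedModule

variable (g : G) {W : Type*} [AddCommGroup W] [Module ℂ W]
  (ρ : Representation ℂ (Subgroup.centralizer ({g} : Set G)) W)

noncomputable section

instance : AddCommGroup (AssociatedModule g ρ) :=
  inferInstanceAs (AddCommGroup (associatedSubmodule g ρ))

instance : Module ℂ (AssociatedModule g ρ) :=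
  inferInstanceAs (Module ℂ (associatedSubmodule g ρ))

open scoped Classical in
/-- The action of `δ_h t`: it sends `f` to `x ↦ [h = x g x⁻¹] f(t⁻¹ x)`. Thus `G` acts by left
translation, and `δ_h` is the projection to the functions supported on
`{x | x g x⁻¹ = h}`. -/
def actE (h t : G) : Module.End ℂ (AssociatedModule g ρ) where
  toFun f := ⟨fun x => if h = x * g * x⁻¹ then f.1 (t⁻¹ * x) else 0, by
    intro x c
    have hc : (c : G) * g * (c : G)⁻¹ = g := by
      rw [mul_inv_eq_iff_eq_mul]
      exact (Subgroup.mem_centralizer_iff.mp c.2 g rfl).symm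
    have h1 : x * (c : G) * g * (x * (c : G))⁻¹ = x * g * x⁻¹ := by
      calc x * (c : G) * g * (x * (c : G))⁻¹ = x * ((c : G) * g * (c : G)⁻¹) * x⁻¹ := by group
        _ = x * g * x⁻¹ := by rw [hc]
    simp only [h1]
    split_ifs
    · rw [← mul_assoc]
      exact f.2 (t⁻¹ * x) c
    · rw [map_zero]⟩
  map_add' a b := by
    apply Subtype.ext
    funext x
    change (if h = x * g * x⁻¹ then a.1 (t⁻¹ * x) + b.1 (t⁻¹ * x) else 0) =
      (if h = x * g * x⁻¹ then a.1 (t⁻¹ * x) else 0) +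
        (if h = x * g * x⁻¹ then b.1 (t⁻¹ * x) else 0)
    split_ifs <;> simp
  map_smul' r a := by
    apply Subtype.ext
    funext x
    change (if h = x * g * x⁻¹ then r • a.1 (t⁻¹ * x) else 0) =
      r • (if h = x * g * x⁻¹ then a.1 (t⁻¹ * x) else 0)
    split_ifs <;> simp

open scoped Classical in
theorem actE_apply (h t : G) (f : AssociatedModule g ρ) (x : G) :
    (actE g ρ h t f).1 x = if h = x * g * x⁻¹ then f.1 (t⁻¹ * x) else 0 := rfl

/-- The action of `D(G)` as a linear map. -/
def act : DrinfeldDouble G →ₗ[ℂ] Module.End ℂ (AssociatedModule g ρ) :=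
  DrinfeldDouble.lift (actE g ρ)

variable [Fintype G]

theorem act_one : act g ρ 1 = 1 := by
  classical
  rw [DrinfeldDouble.one_def, map_sum]
  apply LinearMap.ext
  intro f
  rw [LinearMap.sum_apply]
  apply Subtype.ext
  have h0 : ∀ (s : Finset G) (F : G → AssociatedModule g ρ),
      (∑ i ∈ s, F i).1 = ∑ i ∈ s, (F i).1 :=
    fun s F => map_sum (associatedSubmodule g ρ).subtype F s
  rw [h0]
  funext x
  rw [Finset.sum_apply]
  simp only [act, DrinfeldDouble.lift_e, actE_apply]
  simp

theorem act_mul (a b : DrinfeldDouble G) : act g ρ (a * b) = act g ρ a * act g ρ b := by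
  classical
  have key : (DrinfeldDouble.mulHom (G := G)).compr₂ (act g ρ)
      = (LinearMap.mul ℂ (Module.End ℂ (AssociatedModule g ρ))).compl₁₂
          (act g ρ) (act g ρ) := by
    refine DrinfeldDouble.hom_ext fun h x => DrinfeldDouble.hom_ext fun k y => ?_
    change act g ρ (DrinfeldDouble.e h x * DrinfeldDouble.e k y)
      = act g ρ (DrinfeldDouble.e h x) * act g ρ (DrinfeldDouble.e k y)
    apply LinearMap.ext
    intro f
    apply Subtype.ext
    funext w
    rw [DrinfeldDouble.e_mul_e, Module.End.mul_apply]
    simp only [act, DrinfeldDouble.lift_e, actE_apply]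
    have h0 : x⁻¹ * w * g * (x⁻¹ * w)⁻¹ = x⁻¹ * (w * g * w⁻¹) * x := by group
    rw [h0]
    by_cases h2 : h = w * g * w⁻¹
    · rw [if_pos h2, ← h2]
      have h3 : (k = x⁻¹ * h * x) ↔ h = x * k * x⁻¹ := by
        constructor
        · rintro rfl; group
        · rintro rfl; group
      simp only [h3]
      split_ifs with h4
      · rw [DrinfeldDouble.lift_e, actE_apply, if_pos h2, mul_inv_rev, mul_assoc]
      · rw [map_zero]; rfl
    · rw [if_neg h2]
      split_ifs with h4
      · rw [DrinfeldDouble.lift_e, actE_apply, if_neg h2]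
      · rw [map_zero]; rfl
  exact congrArg (fun f => f a b) key

/-- The action of `D(G)` as a homomorphism of algebras. -/
def actHom : DrinfeldDouble G →ₐ[ℂ] Module.End ℂ (AssociatedModule g ρ) :=
  AlgHom.ofLinearMap (act g ρ) (act_one g ρ) (act_mul g ρ)

instance : Module (DrinfeldDouble G) (AssociatedModule g ρ) :=
  Module.compHom (AssociatedModule g ρ) (actHom g ρ).toRingHom

instance : IsScalarTower ℂ (DrinfeldDouble G) (AssociatedModule g ρ) where
  smul_assoc r a v := by
    change actHom g ρ (r • a) v = r • actHom g ρ a v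
    rw [map_smul, LinearMap.smul_apply]

end

end AssociatedModule

end AssociatedModule

/-- The set `Irr(H)` of irreducible complex characters of `H`. -/
def irrChar (H : Type*) [Group H] : Set (H → ℂ) :=
  {χ | ∃ (n : ℕ) (ρ : Representation ℂ H (Fin n → ℂ)), ρ.IsIrreducible ∧ ρ.character = χ}

/-- The function `γ_m^z` on `C_G(z)`: its value at `g` is the number of all `x ∈ G` with
`x ^ m = (g x) ^ m = z`. -/
noncomputable def gammaFun {G : Type u} [Group G] (m : ℤ) (z : G)
    (g : Subgroup.centralizer ({z} : Set G)) : ℂ :=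
  Nat.card {x : G // x ^ m = z ∧ ((g : G) * x) ^ m = z}

open scoped Classical in
/-- The coefficient `β_m(z, χ)` of the irreducible character `χ` of `C_G(z)` in the class function
`γ_m^z`, computed as the inner product of `γ_m^z` and `χ`. -/
noncomputable def betaCoeff {G : Type u} [Group G] [Fintype G] (m : ℤ) (z : G)
    (χ : Subgroup.centralizer ({z} : Set G) → ℂ) : ℂ :=
  (Fintype.card (Subgroup.centralizer ({z} : Set G)) : ℂ)⁻¹ *
    ∑ g : Subgroup.centralizer ({z} : Set G), gammaFun m z g * starRingEnd ℂ (χ g)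

/-- The cyclotomic field `ℚ(ζ_d)` inside `ℂ`, with `ζ_d = exp(2πi/d)`. -/
noncomputable def cyclotomicSubfield (d : ℕ) : IntermediateField ℚ ℂ :=
  IntermediateField.adjoin ℚ {Complex.exp (2 * Real.pi * Complex.I / d)}

/-! Write N(h,z) for the number of x with x^m = z = (hx)^m (`pairCount`). Both families of numbers
are transforms of this one function on commuting pairs, and each is contained in K = ℚ(ζ_d) exactly
when N(h,z^k) = N(h,z) for all commuting h, z and all k through which some K-endomorphism σ of ℂ
acts on the |G|-th roots of unity. Only the fact that K is a subfield of ℂ matters.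

Indicators: computing Sweedler powers gives ν_m(V) = |G|⁻¹ Σ N(h,z) tr_V(δ_h z)
(`fsIndicator_eq_sum`). The trace vanishes unless h and z commute, and σ sends tr_V(δ_h z) to
tr_V(δ_h z^k). Invariance of N therefore fixes ν_m(V) for every finite-dimensional V. Conversely,
for fixed h the indicators of the modules of (h,η) are, up to a common positive factor, the pairings
of N(h,·) with the irreducible characters of C_G(h), so they determine N.

Coefficients: β_m(z,·) expands N(·,z) on C_G(z). On that group N(·,z) is the autocorrelation of the
central indicator function of x^m = z, so by Schur's lemma β_m(z,χ) is a product of two character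
sums. Applying σ and substituting x ↦ x^k turns it into the coefficient of χ in N(·,z^k)
(`map_betaCoeff`). Hence β_m(z,·) is fixed exactly when N(·,z^k) = N(·,z) on C_G(z).

Membership in K is tested by invariance under all such σ (`mem_of_forall_algHom_fixed`), since all
numbers involved are algebraic. -/

/-! ### Sweedler powers of basis elements -/

namespace DrinfeldDouble

variable {G : Type u} [Group G] [Fintype G]

-- A product of basis elements δ_b x survives only if each label is x⁻¹(·)x of the preceding one.
-- The first label k thus determines all others, and h is their product x^{-(n-1)} k x^{n-1} ⋯ x⁻¹kx
-- · k = x^{-n}(xk)^n.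
open scoped Classical in
theorem conv_pow_id_e (n : ℕ) (h x : G) :
    (WithConv.toConv (LinearMap.id : DrinfeldDouble G →ₗ[ℂ] DrinfeldDouble G) ^ n) (e h x)
      = ∑ k : G, if (x ^ n)⁻¹ * (x * k) ^ n = h then e k (x ^ n) else 0 := by
  induction n generalizing h with
  | zero =>
    rw [pow_zero, LinearMap.convOne_apply]
    erw [counit_e]
    simp only [pow_zero, inv_one, mul_one, eq_comm (a := (1 : G))]
    split_ifs with hh
    · rw [map_one, one_def]
    · rw [map_zero, Finset.sum_const_zero]
  | succ n ih =>
    rw [pow_succ', LinearMap.convMul_apply, comul_e]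
    simp only [map_sum, TensorProduct.map_tmul, LinearMap.mul'_apply, LinearMap.id_apply, ih]
    refine Finset.sum_congr rfl fun b _ => ?_
    rw [Finset.mul_sum, Finset.sum_eq_single (x⁻¹ * b * x)]
    · have h1 : (x ^ n)⁻¹ * (x * (x⁻¹ * b * x)) ^ n = h * b⁻¹ ↔
          (x ^ (n + 1))⁻¹ * (x * b) ^ (n + 1) = h := by
        have h2 : x * (x⁻¹ * b * x) = x⁻¹ * (x * b) * x⁻¹⁻¹ := by group
        rw [h2, conj_pow, eq_mul_inv_iff_mul_eq, pow_succ' x, pow_succ (x * b)]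
        have h3 : (x ^ n)⁻¹ * (x⁻¹ * (x * b) ^ n * x⁻¹⁻¹) * b
            = (x * x ^ n)⁻¹ * ((x * b) ^ n * (x * b)) := by
          simp only [mul_inv_rev, mul_assoc, inv_inv]
        rw [h3]
      rw [if_congr h1 rfl rfl]
      split_ifs
      · rw [e_mul_e, if_pos (by group), ← pow_succ']
      · exact mul_zero _
    · intro k _ hk
      split_ifs
      · rw [e_mul_e, if_neg]
        rintro rfl
        exact hk (by group)
      · exact mul_zero _
    · simp

theorem antipode_e (h x : G) :
    HopfAlgebra.antipode ℂ (e h x) = e (x⁻¹ * h⁻¹ * x) x⁻¹ :=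
  lift_e (fun h x => e (x⁻¹ * h⁻¹ * x) x⁻¹) h x

open scoped Classical in
theorem conv_pow_antipode_e (n : ℕ) (h x : G) :
    (WithConv.toConv (HopfAlgebra.antipode ℂ (A := DrinfeldDouble G)) ^ n) (e h x)
      = ∑ k : G, if x * (x ^ n * ((k * x) ^ n)⁻¹) * x⁻¹ = h then e k ((x ^ n)⁻¹) else 0 := by
  induction n generalizing h with
  | zero =>
    rw [pow_zero, LinearMap.convOne_apply]
    erw [counit_e]
    simp only [pow_zero, inv_one, mul_one, mul_inv_cancel, eq_comm (a := (1 : G))]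
    split_ifs with hh
    · rw [map_one, one_def]
    · rw [map_zero, Finset.sum_const_zero]
  | succ n ih =>
    rw [pow_succ', LinearMap.convMul_apply, comul_e]
    simp only [map_sum, TensorProduct.map_tmul, LinearMap.mul'_apply, ih]
    have hS : ∀ b : G, (WithConv.toConv (HopfAlgebra.antipode ℂ (A := DrinfeldDouble G))) (e b x)
        = e (x⁻¹ * b⁻¹ * x) x⁻¹ := fun b => antipode_e b x
    simp only [hS]
    refine Fintype.sum_equiv ((Equiv.inv G).trans (MulAut.conj x⁻¹).toEquiv) _ _ fun b => ?_
    -- Parametrized so that the antipode sends δ_b x to δ_k x⁻¹; the only label that can follow is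
    -- then x k x⁻¹.
    obtain ⟨k, rfl⟩ : ∃ k, b = (x * k * x⁻¹)⁻¹ := ⟨x⁻¹ * b⁻¹ * x, by group⟩
    have hb : ((Equiv.inv G).trans (MulAut.conj x⁻¹).toEquiv) (x * k * x⁻¹)⁻¹ = k := by
      simp [mul_assoc]
    rw [hb]
    have hb' : x⁻¹ * ((x * k * x⁻¹)⁻¹)⁻¹ * x = k := by group
    rw [hb', Finset.mul_sum, Finset.sum_eq_single (x * k * x⁻¹)]
    · have h1 : x * (x ^ n * ((x * k * x⁻¹ * x) ^ n)⁻¹) * x⁻¹ = h * ((x * k * x⁻¹)⁻¹)⁻¹ ↔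
          x * (x ^ (n + 1) * ((k * x) ^ (n + 1))⁻¹) * x⁻¹ = h := by
        have h2 : x * k * x⁻¹ * x = x * (k * x) * x⁻¹ := by group
        rw [h2, conj_pow, inv_inv, ← mul_inv_eq_iff_eq_mul, pow_succ, pow_succ' (k * x)]
        have h3 : x * (x ^ n * (x * (k * x) ^ n * x⁻¹)⁻¹) * x⁻¹ * (x * k * x⁻¹)⁻¹
            = x * (x ^ n * x * (k * x * (k * x) ^ n)⁻¹) * x⁻¹ := by
          simp only [mul_inv_rev, mul_assoc, inv_inv, inv_mul_cancel_left]
        rw [h3]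
      rw [if_congr h1 rfl rfl]
      split_ifs
      · rw [e_mul_e, if_pos (by group), ← mul_inv_rev, ← pow_succ]
      · exact mul_zero _
    · intro l _ hl
      split_ifs
      · rw [e_mul_e, if_neg]
        intro hh
        exact hl (by rw [hh]; group)
      · exact mul_zero _
    · simp

end DrinfeldDouble

/-! ### Endomorphisms of ℂ over a subfield -/

theorem exists_ringHom_extending_of_isAlgebraic {R S M : Type*} [CommRing R] [IsDomain R]
    [Field S] [Field M] [IsAlgClosed M] [Algebra R S] [FaithfulSMul R S] [Algebra.IsAlgebraic R S]
    (f : R →+* M) (hf : Function.Injective f) :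
    ∃ g : S →+* M, ∀ r, g (algebraMap R S r) = f r := by
  let _ : Algebra R M := f.toAlgebra
  have : FaithfulSMul R M := (faithfulSMul_iff_algebraMap_injective R M).mpr hf
  have h1 : Module.IsTorsionFree R M := inferInstance
  have h2 : Module.IsTorsionFree R S := inferInstance
  exact ⟨(IsAlgClosed.lift : S →ₐ[R] M).toRingHom, fun r => (IsAlgClosed.lift : S →ₐ[R] M).commutes r⟩

/-- Let τ act on the coefficients of polynomials in a transcendence basis, fixing the basis, and
extend along the remaining algebraic extension. Surjectivity of σ is not needed later, so an
embedding suffices. -/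
theorem exists_ringHom_extending_algebraicClosure (K : IntermediateField ℚ ℂ)
    (τ : algebraicClosure K ℂ ≃ₐ[K] algebraicClosure K ℂ) :
    ∃ σ : ℂ →ₐ[K] ℂ, ∀ x : algebraicClosure K ℂ, σ (x : ℂ) = τ x := by
  obtain ⟨s, hs⟩ := exists_isTranscendenceBasis (algebraicClosure K ℂ) ℂ
  let R := Algebra.adjoin (algebraicClosure K ℂ) (Set.range ((↑) : s → ℂ))
  let f : R →+* ℂ := (MvPolynomial.aeval (R := algebraicClosure K ℂ) ((↑) : s → ℂ)).toRingHom.comp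
    ((MvPolynomial.map (τ : algebraicClosure K ℂ →+* algebraicClosure K ℂ)).comp
      (hs.1.aevalEquiv.symm : R →+* MvPolynomial s (algebraicClosure K ℂ)))
  have hf : Function.Injective f := by
    have h1 : Function.Injective (MvPolynomial.aeval (R := algebraicClosure K ℂ) ((↑) : s → ℂ)) :=
      hs.1
    exact h1.comp ((MvPolynomial.map_injective _ τ.injective).comp
      hs.1.aevalEquiv.symm.injective)
  have hR : Algebra.IsAlgebraic R ℂ := hs.isAlgebraic
  obtain ⟨g, hg⟩ := exists_ringHom_extending_of_isAlgebraic (S := ℂ) f hf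
  have hg' : ∀ x : algebraicClosure K ℂ, g (x : ℂ) = τ x := fun x => by
    have h1 : hs.1.aevalEquiv.symm (algebraMap (algebraicClosure K ℂ) R x) = MvPolynomial.C x := by
      rw [AlgEquiv.commutes]; rfl
    have h2 := hg (algebraMap (algebraicClosure K ℂ) R x)
    have h3 : f (algebraMap (algebraicClosure K ℂ) R x) = τ x := by
      change MvPolynomial.aeval (R := algebraicClosure K ℂ) ((↑) : s → ℂ) (MvPolynomial.map
        (τ : algebraicClosure K ℂ →+* algebraicClosure K ℂ) (hs.1.aevalEquiv.symm _)) = _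
      rw [h1, MvPolynomial.map_C, MvPolynomial.aeval_C]
      rfl
    exact h2.trans h3
  refine ⟨{ g with commutes' := fun y => ?_ }, hg'⟩
  have := hg' (algebraMap K _ y)
  rw [τ.commutes] at this
  exact this

/-- The algebraic closure of K in ℂ is Galois over K, and each of its automorphisms is the
restriction of some σ. -/
theorem mem_of_forall_algHom_fixed (K : IntermediateField ℚ ℂ) (x : ℂ) (hx : IsIntegral ℚ x)
    (h : ∀ σ : ℂ →ₐ[K] ℂ, σ x = x) : x ∈ K := by
  have hx' : x ∈ algebraicClosure K ℂ := mem_algebraicClosure_iff.mpr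
    (hx.isAlgebraic.extendScalars (algebraMap ℚ K).injective)
  have : IsGalois K (algebraicClosure K ℂ) := {}
  obtain ⟨y, hy⟩ := (InfiniteGalois.mem_range_algebraMap_iff_fixed
    (k := K) (⟨x, hx'⟩ : algebraicClosure K ℂ)).mpr fun τ => by
      obtain ⟨σ, hσ⟩ := exists_ringHom_extending_algebraicClosure K τ
      apply Subtype.ext
      rw [← hσ]
      exact h σ
  have := congrArg Subtype.val hy
  rw [show x = (y : ℂ) from this.symm]
  exact y.2

theorem exists_coprime_pow_of_ringHom (e : ℕ) (he : 0 < e) (σ : ℂ →+* ℂ) :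
    ∃ k : ℕ, k ≠ 0 ∧ k.Coprime e ∧ ∀ ω : ℂ, ω ^ e = 1 → σ ω = ω ^ k := by
  have : NeZero e := ⟨he.ne'⟩
  have hζ := Complex.isPrimitiveRoot_exp e he.ne'
  obtain ⟨k, hk, hke, hσ⟩ := (hζ.isPrimitiveRoot_iff).mp (hζ.map_of_injective σ.injective)
  -- Adding e keeps the class mod e and makes the exponent nonzero even for e = 1; zero eigenvalues
  -- below require this.
  refine ⟨k + e, by omega, by simpa using hke, fun ω hω => ?_⟩
  obtain ⟨j, -, rfl⟩ := hζ.eq_pow_of_pow_eq_one hω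
  rw [map_pow, ← hσ, pow_add, hω, mul_one, pow_right_comm]

/-! ### Galois action on traces -/

section TracePowers

variable {V : Type*} [AddCommGroup V] [Module ℂ V] [FiniteDimensional ℂ V]

/-- The trace of an endomorphism whose eigenvalues are zero or `e`-th roots of unity. -/
theorem exists_trace_pow_eq_sum (T : Module.End ℂ V) (e : ℕ) (he : 0 < e) (hT : T ^ (e + 1) = T)
    {ζ : ℂ} (hζ : IsPrimitiveRoot ζ e) :
    ∃ M : ℕ → ℕ, ∀ k : ℕ, k ≠ 0 →
      LinearMap.trace ℂ V (T ^ k) = ∑ j ∈ Finset.range e, (M j : ℂ) * ζ ^ (j * k) := by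
  have he0 : (e : ℂ) ≠ 0 := Nat.cast_ne_zero.mpr he.ne'
  have hζ0 : ζ ≠ 0 := hζ.ne_zero he.ne'
  have hper : ∀ k, T ^ (k + 1 + e) = T ^ (k + 1) := fun k => by
    rw [show k + 1 + e = k + (e + 1) by ring, pow_add, hT, pow_succ]
  -- Fourier projection onto the ζ^j-eigenspace. The exponents run over 1, …, e instead of 0, …, e-1
  -- so that the kernel of T is annihilated.
  let E : ℕ → Module.End ℂ V := fun j =>
    (e : ℂ)⁻¹ • ∑ i ∈ Finset.range e, (ζ⁻¹) ^ (j * (i + 1)) • T ^ (i + 1)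
  have hTE : ∀ j, T * E j = ζ ^ j • E j := by
    intro j
    simp only [E, mul_smul_comm, Finset.mul_sum]
    rw [smul_comm (ζ ^ j)]
    congr 1
    have h1 : ∀ i, T * T ^ (i + 1) = T ^ (i + 1 + 1) := fun i => (pow_succ' _ _).symm
    simp only [h1]
    have h2 : ∀ i, (ζ⁻¹) ^ (j * (i + 1)) = ζ ^ j * ζ⁻¹ ^ (j * (i + 1 + 1)) := by
      intro i
      rw [show j * (i + 1 + 1) = j * (i + 1) + j by ring, pow_add, mul_left_comm, ← mul_pow,
        mul_inv_cancel₀ hζ0, one_pow, mul_one]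
    have h3 : ∑ i ∈ Finset.range e, (ζ⁻¹) ^ (j * (i + 1)) • T ^ (i + 1 + 1)
        = ∑ i ∈ Finset.range e, (ζ ^ j * ζ⁻¹ ^ (j * (i + 1 + 1))) • T ^ (i + 1 + 1) :=
      Finset.sum_congr rfl fun i _ => by rw [← h2]
    rw [h3, Finset.smul_sum]
    simp only [smul_smul]
    -- The two sums differ by an index shift, harmless because the summand takes equal values at 0
    -- and e.
    let F : ℕ → Module.End ℂ V := fun i => (ζ ^ j * ζ⁻¹ ^ (j * (i + 1))) • T ^ (i + 1)
    change ∑ i ∈ Finset.range e, F (i + 1) = ∑ i ∈ Finset.range e, F i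
    have hF : F e = F 0 := by
      simp only [F]
      have := hper 0
      rw [zero_add, add_comm] at this
      rw [this, show j * (e + 1) = e * j + j * (0 + 1) by ring, pow_add, pow_mul, inv_pow,
        hζ.pow_eq_one, inv_one, one_pow, one_mul]
    have := Finset.sum_range_succ F e
    rw [Finset.sum_range_succ', hF] at this
    exact add_right_cancel this
  have hTkE : ∀ k j, T ^ k * E j = ζ ^ (j * k) • E j := by
    intro k j
    induction k with
    | zero => simp
    | succ k ih => rw [pow_succ, mul_assoc, hTE, mul_smul_comm, ih, smul_smul, mul_add_one,
        pow_add, mul_comm]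
  have hidem : ∀ j, IsIdempotentElem (E j) := by
    intro j
    change E j * E j = E j
    conv_lhs => enter [1]; simp only [E]
    rw [smul_mul_assoc, Finset.sum_mul]
    simp only [smul_mul_assoc, hTkE, smul_smul, ← mul_pow, inv_mul_cancel₀ hζ0, one_pow, one_smul,
      Finset.sum_const, Finset.card_range]
    rw [← Nat.cast_smul_eq_nsmul ℂ, smul_smul, inv_mul_cancel₀ he0, one_smul]
  have hsumE : T = ∑ j ∈ Finset.range e, ζ ^ j • E j := by
    have h1 : ∀ j, ζ ^ j • E j
        = (e : ℂ)⁻¹ • ∑ i ∈ Finset.range e, ((ζ⁻¹ ^ i) ^ j) • T ^ (i + 1) := by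
      intro j
      simp only [E]
      rw [smul_comm, Finset.smul_sum]
      congr 1
      refine Finset.sum_congr rfl fun i _ => ?_
      rw [smul_smul, mul_add_one, pow_add, mul_comm, mul_assoc, ← mul_pow, inv_mul_cancel₀ hζ0,
        one_pow, mul_one, mul_comm j, pow_mul]
    simp only [h1]
    rw [← Finset.smul_sum, Finset.sum_comm]
    simp only [← Finset.sum_smul]
    rw [Finset.sum_eq_single_of_mem 0 (Finset.mem_range.mpr he)]
    · simp only [pow_zero, one_pow, Finset.sum_const, Finset.card_range, zero_add, pow_one,
        nsmul_eq_mul, mul_one]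
      rw [smul_smul, inv_mul_cancel₀ he0, one_smul]
    · intro i hi hi0
      have h2 : ζ⁻¹ ^ i ≠ 1 := hζ.inv.pow_ne_one_of_pos_of_lt hi0 (Finset.mem_range.mp hi)
      rw [geom_sum_eq h2, ← pow_mul, mul_comm, pow_mul, hζ.inv.pow_eq_one, one_pow, sub_self,
        zero_div, zero_smul]
  have hsum : ∀ k, T ^ (k + 1) = ∑ j ∈ Finset.range e, ζ ^ (j * (k + 1)) • E j := by
    intro k
    rw [pow_succ]
    conv_lhs => enter [2]; rw [hsumE]
    rw [Finset.mul_sum]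
    refine Finset.sum_congr rfl fun j _ => ?_
    rw [mul_smul_comm, hTkE, smul_smul, ← pow_add]
    congr 2; ring
  -- The multiplicity of ζ^j is the rank of the idempotent E j, which is also its trace.
  refine ⟨fun j => Module.finrank ℂ (LinearMap.range (E j)), fun k hk => ?_⟩
  obtain ⟨k, rfl⟩ := Nat.exists_eq_succ_of_ne_zero hk
  rw [Nat.succ_eq_add_one, hsum, map_sum]
  refine Finset.sum_congr rfl fun j _ => ?_
  rw [map_smul, (LinearMap.IsIdempotentElem.isProj_range _ (hidem j)).trace, smul_eq_mul, mul_comm]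

theorem map_trace_eq_trace_pow (T : Module.End ℂ V) (e : ℕ) (he : 0 < e) (hT : T ^ (e + 1) = T)
    (σ : ℂ →+* ℂ) (k : ℕ) (hk : k ≠ 0) (hσ : ∀ ω : ℂ, ω ^ e = 1 → σ ω = ω ^ k) :
    σ (LinearMap.trace ℂ V T) = LinearMap.trace ℂ V (T ^ k) := by
  have hζ := Complex.isPrimitiveRoot_exp e he.ne'
  obtain ⟨M, hM⟩ := exists_trace_pow_eq_sum T e he hT hζ
  have h1 := hM 1 one_ne_zero
  rw [pow_one] at h1
  rw [h1, hM k hk, map_sum]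
  refine Finset.sum_congr rfl fun j _ => ?_
  rw [map_mul, map_natCast, mul_one, map_pow, hσ _ hζ.pow_eq_one, ← pow_mul, mul_comm k]

theorem isIntegral_trace_of_pow_succ_eq (T : Module.End ℂ V) (e : ℕ) (he : 0 < e)
    (hT : T ^ (e + 1) = T) : IsIntegral ℚ (LinearMap.trace ℂ V T) := by
  have hζ := Complex.isPrimitiveRoot_exp e he.ne'
  obtain ⟨M, hM⟩ := exists_trace_pow_eq_sum T e he hT hζ
  have h1 := hM 1 one_ne_zero
  rw [pow_one] at h1
  rw [h1]
  refine IsIntegral.sum _ fun j _ => IsIntegral.mul (isIntegral_natCast _) (IsIntegral.pow ?_ _)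
  exact (hζ.isIntegral he).tower_top

end TracePowers

/-- The number of `x` with `x ^ m = z = (h x) ^ m`. -/
noncomputable def pairCount {G : Type u} [Group G] (m : ℤ) (h z : G) : ℕ :=
  Nat.card {x : G // x ^ m = z ∧ (h * x) ^ m = z}

/-! ### Indicators as sums over commuting pairs -/

namespace DrinfeldDouble

variable {G : Type u} [Group G] [Fintype G]

theorem e_pow {h z : G} (hz : h * z = z * h) (k : ℕ) :
    (e h z) ^ (k + 1) = e h (z ^ (k + 1)) := by
  classical
  induction k with
  | zero => simp
  | succ k ih =>
    rw [pow_succ, ih, e_mul_e, if_pos, ← pow_succ]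
    have : Commute h (z ^ (k + 1)) := Commute.pow_right hz _
    rw [← this.eq, mul_inv_cancel_right]

/-- The value at `a` of the character of `V`. -/
noncomputable def moduleTrace (V : Type*) [AddCommGroup V] [Module ℂ V]
    [Module (DrinfeldDouble G) V] [IsScalarTower ℂ (DrinfeldDouble G) V] :
    DrinfeldDouble G →ₗ[ℂ] ℂ :=
  LinearMap.trace ℂ V ∘ₗ (Algebra.lsmul ℂ ℂ V).toLinearMap

variable (V : Type*) [AddCommGroup V] [Module ℂ V]
    [Module (DrinfeldDouble G) V] [IsScalarTower ℂ (DrinfeldDouble G) V]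

theorem moduleTrace_mul_comm (a b : DrinfeldDouble G) :
    moduleTrace V (a * b) = moduleTrace V (b * a) := by
  simp only [moduleTrace, LinearMap.comp_apply, AlgHom.toLinearMap_apply, map_mul]
  exact LinearMap.trace_mul_comm ℂ _ _

/-- Under the trace the idempotent δ_h can be moved from the left of δ_h z to its right, where the
product is zero unless z centralizes h. -/
theorem moduleTrace_e_of_ne {h z : G} (hz : h * z ≠ z * h) : moduleTrace V (e h z) = 0 := by
  classical
  have h1 : e h z = e h 1 * e h z := by rw [e_mul_e, if_pos (by group), one_mul]
  rw [h1, moduleTrace_mul_comm, e_mul_e, if_neg, map_zero]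
  exact fun h2 => hz (eq_mul_inv_iff_mul_eq.mp h2)

theorem moduleTrace_e_conj (h z x : G) :
    moduleTrace V (e (x * h * x⁻¹) (x * z * x⁻¹)) = moduleTrace V (e h z) := by
  classical
  have h1 : e (x * h * x⁻¹) (x * z * x⁻¹) = e (x * h * x⁻¹) x * e h (z * x⁻¹) := by
    rw [e_mul_e, if_pos rfl, ← mul_assoc]
  rw [h1, moduleTrace_mul_comm, e_mul_e]
  by_cases hz : h * z = z * h
  · rw [if_pos, inv_mul_cancel_right]
    rw [show z * x⁻¹ * (x * h * x⁻¹) * (z * x⁻¹)⁻¹ = z * h * z⁻¹ by group, ← hz,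
      mul_inv_cancel_right]
  · rw [moduleTrace_e_of_ne V hz, if_neg, map_zero]
    intro h2
    apply hz
    rw [show z * x⁻¹ * (x * h * x⁻¹) * (z * x⁻¹)⁻¹ = z * h * z⁻¹ by group] at h2
    exact eq_mul_inv_iff_mul_eq.mp h2

open scoped Classical in
theorem moduleTrace_sweedlerPower_e (m : ℤ) (x : G) :
    moduleTrace V (sweedlerPower m (e 1 x))
      = ∑ k : G, if (k * x) ^ m = x ^ m then moduleTrace V (e k (x ^ m)) else 0 := by
  obtain n | n := m
  · change moduleTrace V ((WithConv.toConv LinearMap.id ^ n) (e 1 x)) = _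
    rw [conv_pow_id_e, map_sum]
    refine Finset.sum_congr rfl fun k _ => ?_
    rw [apply_ite (moduleTrace V), map_zero]
    simp only [Int.ofNat_eq_natCast, zpow_natCast, inv_mul_eq_one]
    -- The powers of xk and kx are conjugate by k, so the two conditions agree if k commutes with
    -- x^n; otherwise the trace is zero.
    by_cases hk : k * x ^ n = x ^ n * k
    · refine if_congr ?_ rfl rfl
      have h1 : (k * x) ^ n = k * (x * k) ^ n * k⁻¹ := by
        rw [← conj_pow]; congr 1; group
      rw [h1, mul_inv_eq_iff_eq_mul, ← hk, mul_right_inj, eq_comm]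
    · rw [moduleTrace_e_of_ne V hk, ite_self, ite_self]
  · change moduleTrace V ((WithConv.toConv (HopfAlgebra.antipode ℂ (A := DrinfeldDouble G))
      ^ (n + 1)) (e 1 x)) = _
    rw [conv_pow_antipode_e, map_sum]
    refine Finset.sum_congr rfl fun k _ => ?_
    rw [apply_ite (moduleTrace V), map_zero]
    simp only [zpow_negSucc, inv_inj]
    refine if_congr ?_ rfl rfl
    rw [conj_eq_one_iff, mul_inv_eq_one, eq_comm]

theorem sweedlerPower_linear (m : ℤ) :
    ∃ L : DrinfeldDouble G →ₗ[ℂ] DrinfeldDouble G, ∀ a, sweedlerPower m a = L a := by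
  obtain n | n := m
  · exact ⟨_, fun a => rfl⟩
  · exact ⟨_, fun a => rfl⟩

/-- The indicator of any module in terms of its character. -/
theorem fsIndicator_eq_sum (m : ℤ) :
    fsIndicator G m V = (Fintype.card G : ℂ)⁻¹ *
      ∑ h : G, ∑ z : G, (pairCount m h z : ℂ) * moduleTrace V (e h z) := by
  classical
  obtain ⟨L, hL⟩ := sweedlerPower_linear (G := G) m
  change moduleTrace V (sweedlerPower m (integral G)) = _
  rw [hL, integral, map_smul, map_smul, map_sum, map_sum, smul_eq_mul]
  simp only [← hL, moduleTrace_sweedlerPower_e]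
  rw [Finset.sum_comm]
  congr 1
  refine Finset.sum_congr rfl fun h _ => ?_
  -- Group the x by their m-th power z.
  have h1 : ∀ z : G, (pairCount m h z : ℂ) * moduleTrace V (e h z)
      = ∑ x : G, if x ^ m = z then (if (h * x) ^ m = x ^ m then moduleTrace V (e h (x ^ m)) else 0)
        else 0 := by
    intro z
    have h2 : ∀ x : G, (if x ^ m = z then
        (if (h * x) ^ m = x ^ m then moduleTrace V (e h (x ^ m)) else 0) else 0)
        = if x ^ m = z ∧ (h * x) ^ m = z then moduleTrace V (e h z) else 0 := by
      intro x
      by_cases hx : x ^ m = z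
      · simp [hx]
      · simp [hx]
    simp only [h2]
    rw [← Finset.sum_filter, Finset.sum_const, nsmul_eq_mul, pairCount, Nat.card_eq_fintype_card,
      Fintype.card_subtype]
  simp only [h1]
  rw [Finset.sum_comm]
  simp

/-- The |G|-th power of δ_h z is the projection δ_h, not the identity, which is why the trace lemmas
assume T^(e+1) = T and allow the eigenvalue 0. -/
theorem lsmul_e_pow_card [FiniteDimensional ℂ V] {h z : G} (hz : h * z = z * h) :
    (Algebra.lsmul ℂ ℂ V (e h z)) ^ (Fintype.card G + 1) = Algebra.lsmul ℂ ℂ V (e h z) := by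
  rw [← map_pow, e_pow hz, pow_succ, pow_card_eq_one, one_mul]

theorem commute_pow_iff {k : ℕ} (hk : k.Coprime (Fintype.card G)) (h z : G) :
    h * z ^ k = z ^ k * h ↔ h * z = z * h := by
  refine ⟨fun H => ?_, fun H => Commute.pow_right H k⟩
  obtain ⟨l, hl⟩ : ∃ l : ℕ, (z ^ k) ^ l = z :=
    exists_pow_eq_self_of_coprime (hk.coprime_dvd_right (orderOf_dvd_card))
  have : Commute h ((z ^ k) ^ l) := Commute.pow_right H l
  rwa [hl] at this

theorem map_moduleTrace_e [FiniteDimensional ℂ V] (σ : ℂ →+* ℂ) (k : ℕ) (hk : k ≠ 0)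
    (hkG : k.Coprime (Fintype.card G)) (hσ : ∀ ω : ℂ, ω ^ Fintype.card G = 1 → σ ω = ω ^ k)
    (h z : G) : σ (moduleTrace V (e h z)) = moduleTrace V (e h (z ^ k)) := by
  by_cases hz : h * z = z * h
  · obtain ⟨l, rfl⟩ := Nat.exists_eq_succ_of_ne_zero hk
    have := map_trace_eq_trace_pow _ _ Fintype.card_pos (lsmul_e_pow_card V hz) σ _ hk hσ
    rw [← map_pow, Nat.succ_eq_add_one, e_pow hz] at this
    exact this
  · rw [moduleTrace_e_of_ne V hz, map_zero, moduleTrace_e_of_ne]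
    rwa [Ne, commute_pow_iff hkG]

theorem isIntegral_moduleTrace_e [FiniteDimensional ℂ V] (h z : G) :
    IsIntegral ℚ (moduleTrace V (e h z)) := by
  by_cases hz : h * z = z * h
  · exact isIntegral_trace_of_pow_succ_eq _ _ Fintype.card_pos (lsmul_e_pow_card V hz)
  · rw [moduleTrace_e_of_ne V hz]
    exact isIntegral_zero

theorem isIntegral_fsIndicator [FiniteDimensional ℂ V] (m : ℤ) :
    IsIntegral ℚ (fsIndicator G m V) := by
  rw [fsIndicator_eq_sum]
  refine IsIntegral.mul ?_ (IsIntegral.sum _ fun h _ => IsIntegral.sum _ fun z _ =>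
    (isIntegral_natCast _).mul (isIntegral_moduleTrace_e V h z))
  have := isIntegral_algebraMap (R := ℚ) (A := ℂ) (x := (Fintype.card G : ℚ)⁻¹)
  rwa [map_inv₀, map_natCast] at this

/-- The action of a field automorphism on indicators. -/
theorem map_fsIndicator [FiniteDimensional ℂ V] (m : ℤ) (σ : ℂ →+* ℂ) (k : ℕ) (hk : k ≠ 0)
    (hkG : k.Coprime (Fintype.card G)) (hσ : ∀ ω : ℂ, ω ^ Fintype.card G = 1 → σ ω = ω ^ k) :
    σ (fsIndicator G m V) = (Fintype.card G : ℂ)⁻¹ *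
      ∑ h : G, ∑ z : G, (pairCount m h z : ℂ) * moduleTrace V (e h (z ^ k)) := by
  simp only [fsIndicator_eq_sum, map_mul, map_inv₀, map_natCast, map_sum,
    map_moduleTrace_e V σ k hk hkG hσ]

theorem sum_pairCount_pow_mul (m : ℤ) (k : ℕ) (hkG : k.Coprime (Fintype.card G)) (h : G) :
    ∑ z : G, (pairCount m h (z ^ k) : ℂ) * moduleTrace V (e h (z ^ k))
      = ∑ z : G, (pairCount m h z : ℂ) * moduleTrace V (e h z) := by
  have hk' : (Nat.card G).Coprime k := by rw [Nat.card_eq_fintype_card]; exact hkG.symm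
  exact Fintype.sum_equiv (powCoprime hk') _ _ fun z => rfl

/-- After the substitution z ↦ z^k, a permutation of G, the two sums agree term by term; at
non-commuting pairs both terms vanish. -/
theorem map_fsIndicator_eq_self [FiniteDimensional ℂ V] (m : ℤ) (σ : ℂ →+* ℂ) (k : ℕ) (hk : k ≠ 0)
    (hkG : k.Coprime (Fintype.card G)) (hσ : ∀ ω : ℂ, ω ^ Fintype.card G = 1 → σ ω = ω ^ k)
    (hN : ∀ h z : G, h * z = z * h → pairCount m h (z ^ k) = pairCount m h z) :
    σ (fsIndicator G m V) = fsIndicator G m V := by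
  rw [map_fsIndicator V m σ k hk hkG hσ, fsIndicator_eq_sum]
  congr 1
  refine Finset.sum_congr rfl fun h _ => ?_
  rw [← sum_pairCount_pow_mul V m k hkG]
  refine Finset.sum_congr rfl fun z _ => ?_
  by_cases hz : h * z = z * h
  · rw [hN h z hz]
  · rw [moduleTrace_e_of_ne V (by rwa [Ne, commute_pow_iff hkG]), mul_zero, mul_zero]

end DrinfeldDouble

/-! ### Irreducible characters and class functions -/

namespace Representation

section

variable {H : Type*} [Group H] {V W : Type*} [AddCommGroup V] [Module ℂ V] [AddCommGroup W]
  [Module ℂ W]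

theorem IsIrreducible.of_equiv {ρ : Representation ℂ H V} {σ : Representation ℂ H W}
    (hρ : ρ.IsIrreducible) (φ : ρ.Equiv σ) : σ.IsIrreducible := by
  rw [irreducible_iff_isSimpleModule_asModule] at hρ ⊢
  have e : ρ.asModule ≃ₗ[MonoidAlgebra ℂ H] σ.asModule :=
    LinearEquiv.ofBijective (IntertwiningMap.equivLinearMapAsModule ρ σ φ.toIntertwiningMap)
      φ.toLinearEquiv.bijective
  exact IsSimpleModule.congr e.symm

theorem character_mem_irrChar [FiniteDimensional ℂ V] {ρ : Representation ℂ H V}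
    (hρ : ρ.IsIrreducible) : ρ.character ∈ irrChar H := by
  let b := (Module.finBasis ℂ V).equivFun
  let σ : Representation ℂ H (Fin (Module.finrank ℂ V) → ℂ) :=
    (b.conjAlgEquiv ℂ : Module.End ℂ V →* Module.End ℂ _).comp ρ
  let φ : ρ.Equiv σ := Equiv.mk b fun g => by
    ext v
    simp [σ]
  exact ⟨_, σ, hρ.of_equiv φ, (char_iso φ).symm⟩

theorem finrank_ne_zero_of_isIrreducible [FiniteDimensional ℂ V] {ρ : Representation ℂ H V}
    (hρ : ρ.IsIrreducible) : (Module.finrank ℂ V : ℂ) ≠ 0 := by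
  rw [irreducible_iff_isSimpleModule_asModule] at hρ
  have : Nontrivial V := IsSimpleModule.nontrivial (MonoidAlgebra ℂ H) ρ.asModule
  exact_mod_cast Module.finrank_pos.ne'

variable [Fintype H]

omit [Fintype H] in
theorem map_character (ρ : Representation ℂ H V) [FiniteDimensional ℂ V] (σ : ℂ →+* ℂ) (e k : ℕ)
    (he : 0 < e) (hcard : ∀ h : H, h ^ e = 1) (hk : k ≠ 0) (hσ : ∀ ω : ℂ, ω ^ e = 1 → σ ω = ω ^ k)
    (h : H) : σ (ρ.character h) = ρ.character (h ^ k) := by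
  unfold character
  rw [map_pow]
  refine map_trace_eq_trace_pow _ e he ?_ σ k hk hσ
  rw [← map_pow, pow_succ, hcard, one_mul]

theorem isIntegral_character (ρ : Representation ℂ H V) [FiniteDimensional ℂ V] (h : H) :
    IsIntegral ℚ (ρ.character h) := by
  refine isIntegral_trace_of_pow_succ_eq _ (Fintype.card H) Fintype.card_pos ?_
  rw [← map_pow, pow_succ, pow_card_eq_one, one_mul]

theorem conj_character (ρ : Representation ℂ H V) [FiniteDimensional ℂ V] (h : H) :
    starRingEnd ℂ (ρ.character h) = ρ.character h⁻¹ := by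
  have hc : 0 < Fintype.card H := Fintype.card_pos
  -- Conjugation inverts roots of unity. The exponent 2|H|-1 is -1 mod |H| and, unlike |H|-1,
  -- nonzero for the trivial group.
  rw [map_character ρ (starRingEnd ℂ) (Fintype.card H) (2 * Fintype.card H - 1) hc
    (fun h => pow_card_eq_one) (by omega)]
  · congr 1
    rw [eq_inv_iff_mul_eq_one, ← pow_succ, Nat.sub_add_cancel (by omega), mul_comm, pow_mul,
      pow_card_eq_one, one_pow]
  · intro ω hω
    have h0 : ω ≠ 0 := by
      rintro rfl
      rw [zero_pow hc.ne'] at hω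
      exact zero_ne_one hω
    have hn : ‖ω‖ = 1 := Complex.norm_eq_one_of_pow_eq_one hω hc.ne'
    rw [← Complex.inv_eq_conj hn, eq_comm, ← mul_left_inj' h0, ← pow_succ,
      Nat.sub_add_cancel (by omega), mul_comm, pow_mul, hω, one_pow, inv_mul_cancel₀ h0]

/-- A central element of the group algebra acts on an irreducible representation as a scalar. -/
theorem sum_smul_eq_smul_one [FiniteDimensional ℂ V] {ρ : Representation ℂ H V}
    (hρ : ρ.IsIrreducible) (f : H → ℂ) (hf : ∀ g h, f (h * g * h⁻¹) = f g) :
    ∑ g, f g • ρ g = ((∑ g, f g * ρ.character g) / Module.finrank ℂ V) • 1 := by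
  have hcomm : ∀ h, (∑ g, f g • ρ g) ∘ₗ ρ h = ρ h ∘ₗ ∑ g, f g • ρ g := by
    intro h
    change (∑ g, f g • ρ g) * ρ h = ρ h * ∑ g, f g • ρ g
    rw [Finset.sum_mul, Finset.mul_sum]
    refine Fintype.sum_equiv (MulAut.conj h⁻¹).toEquiv _ _ fun g => ?_
    have h1 : (MulAut.conj h⁻¹).toEquiv g = h⁻¹ * g * h⁻¹⁻¹ := rfl
    rw [h1, hf, smul_mul_assoc, mul_smul_comm, ← map_mul, ← map_mul]
    congr 2
    group
  -- Schur's lemma makes this intertwiner a scalar, and taking traces identifies the scalar.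
  let T : IntertwiningMap ρ ρ := ⟨∑ g, f g • ρ g, hcomm⟩
  obtain ⟨c, hc⟩ := (IsIrreducible.algebraMap_intertwiningMap_bijective_of_isAlgClosed
    (k := ℂ) (ρ := ρ)).2 T
  have hc' : ∑ g, f g • ρ g = c • (1 : Module.End ℂ V) :=
    (congrArg IntertwiningMap.toLinearMap hc).symm
  have htr := congrArg (LinearMap.trace ℂ V) hc'
  rw [map_sum, map_smul, LinearMap.trace_one] at htr
  simp only [map_smul, smul_eq_mul] at htr
  have hd := finrank_ne_zero_of_isIrreducible hρ
  rw [hc']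
  congr 1
  rw [eq_div_iff hd, ← htr]
  rfl

end

section

variable {H : Type*} [Group H] [Fintype H]

omit [Fintype H] in
theorem irreducible_ofModule' (M : Type*) [AddCommGroup M] [Module ℂ M]
    [Module (MonoidAlgebra ℂ H) M] [IsScalarTower ℂ (MonoidAlgebra ℂ H) M]
    [IsSimpleModule (MonoidAlgebra ℂ H) M] :
    (ofModule' (k := ℂ) (G := H) M).IsIrreducible := by
  rw [irreducible_iff_isSimpleModule_asModule]
  let ρ : Representation ℂ H M := ofModule' M
  have hρ : ρ.asAlgebraHom = Algebra.lsmul ℂ ℂ M :=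
    (MonoidAlgebra.lift ℂ (M →ₗ[ℂ] M) H).apply_symm_apply _
  let e : ρ.asModule ≃ₗ[MonoidAlgebra ℂ H] M :=
    { ρ.asModuleEquiv with
      map_smul' := fun r x => by
        change ρ.asModuleEquiv (r • x) = r • ρ.asModuleEquiv x
        rw [asModuleEquiv_map_smul, hρ]
        rfl }
  exact IsSimpleModule.congr e

/-- The irreducible characters span the class functions. -/
theorem eq_zero_of_forall_irrChar (f : H → ℂ) (hf : ∀ g h, f (h * g * h⁻¹) = f g)
    (horth : ∀ χ ∈ irrChar H, ∑ g, f g * χ g = 0) : f = 0 := by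
  have : NeZero (Nat.card H : ℂ) := ⟨Nat.cast_ne_zero.mpr Nat.card_pos.ne'⟩
  let a : MonoidAlgebra ℂ H := ∑ g, MonoidAlgebra.single g (f g)
  -- By orthogonality the central element a acts as zero on each simple quotient by a maximal left
  -- ideal, so it lies in the radical, which vanishes by Maschke's theorem.
  have hj : a ∈ Module.jacobson (MonoidAlgebra ℂ H) (MonoidAlgebra ℂ H) := by
    refine Submodule.mem_sInf.mpr fun M hM => ?_
    have hs : IsSimpleModule (MonoidAlgebra ℂ H) (MonoidAlgebra ℂ H ⧸ M) :=
      isSimpleModule_iff_isCoatom.mpr hM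
    have : FiniteDimensional ℂ (MonoidAlgebra ℂ H) :=
      Module.Finite.equiv (MonoidAlgebra.coeffLinearEquiv ℂ).symm
    have : FiniteDimensional ℂ (MonoidAlgebra ℂ H ⧸ M) :=
      Module.Finite.of_surjective (M.mkQ.restrictScalars ℂ) M.mkQ_surjective
    let ρ : Representation ℂ H (MonoidAlgebra ℂ H ⧸ M) := ofModule' _
    have hρ : ρ.IsIrreducible := irreducible_ofModule' _
    have h1 := sum_smul_eq_smul_one hρ f hf
    rw [horth _ (character_mem_irrChar hρ), zero_div, zero_smul] at h1
    have h2 := LinearMap.congr_fun h1 (M.mkQ 1)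
    rw [LinearMap.sum_apply] at h2
    have h3 : ∀ g, (f g • ρ g) (M.mkQ 1) = M.mkQ (MonoidAlgebra.single g (f g)) := by
      intro g
      have h4 : ρ g (M.mkQ 1) = M.mkQ (MonoidAlgebra.single g 1) := by
        change (MonoidAlgebra.lift ℂ _ H).symm (Algebra.lsmul ℂ ℂ (MonoidAlgebra ℂ H ⧸ M)) g
          (M.mkQ 1) = _
        rw [MonoidAlgebra.lift_symm_apply, Algebra.lsmul_coe]
        change MonoidAlgebra.single g 1 • M.mkQ 1 = _
        rw [← map_smul, smul_eq_mul, mul_one]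
      rw [LinearMap.smul_apply, h4]
      change f g • (M.mkQ.restrictScalars ℂ) _ = _
      rw [← map_smul, MonoidAlgebra.smul_single, smul_eq_mul, mul_one]
      rfl
    simp only [h3] at h2
    rw [← map_sum] at h2
    exact (Submodule.Quotient.mk_eq_zero M).mp h2
  have ha : a = 0 := by
    rw [IsSemisimpleModule.jacobson_eq_bot] at hj
    exact hj
  classical
  funext g
  have := congrArg (fun b : MonoidAlgebra ℂ H => b.coeff g) ha
  simp only [a, MonoidAlgebra.coeff_sum, MonoidAlgebra.coeff_single, Finsupp.finsetSum_apply,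
    Finsupp.single_apply, Finset.sum_ite_eq', Finset.mem_univ, if_true] at this
  exact this

noncomputable instance : Invertible (Nat.card H : ℂ) :=
  invertibleOfNonzero (Nat.cast_ne_zero.mpr Nat.card_pos.ne')

open scoped Classical in
theorem irrChar_orthonormal {χ ψ : H → ℂ} (hχ : χ ∈ irrChar H) (hψ : ψ ∈ irrChar H) :
    (Fintype.card H : ℂ)⁻¹ * ∑ g, χ g * starRingEnd ℂ (ψ g) = if χ = ψ then 1 else 0 := by
  obtain ⟨n, ρ, hρ, rfl⟩ := hχ
  obtain ⟨n', ρ', hρ', rfl⟩ := hψ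
  simp only [conj_character]
  have h1 := char_orthonormal ρ ρ'
  rw [Nat.card_eq_fintype_card] at h1
  rw [h1]
  refine if_congr ⟨fun ⟨φ⟩ => (char_iso φ).symm, fun h2 => ?_⟩ rfl rfl
  -- Non-isomorphic representations with equal characters would have inner product both 0 and 1.
  by_contra h3
  have h4 := char_orthonormal ρ ρ
  rw [Nat.card_eq_fintype_card, if_pos ⟨Equiv.refl ρ⟩] at h4
  rw [if_neg h3, ← h2, h4] at h1
  exact one_ne_zero h1

/-- Orthonormality gives linear independence in the finite-dimensional space of functions on H. -/
theorem irrChar_finite : (irrChar H).Finite := by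
  classical
  have hli : LinearIndependent ℂ ((↑) : irrChar H → H → ℂ) := by
    rw [linearIndependent_iff']
    intro s c hc ψ hψ
    have h1 : ∑ χ ∈ s, c χ * ((Fintype.card H : ℂ)⁻¹ * ∑ g, χ.1 g * starRingEnd ℂ (ψ.1 g)) = 0 := by
      have h2 : ∀ χ, c χ * ((Fintype.card H : ℂ)⁻¹ * ∑ g, χ.1 g * starRingEnd ℂ (ψ.1 g))
          = (Fintype.card H : ℂ)⁻¹ * ∑ g, (c χ * χ.1 g) * starRingEnd ℂ (ψ.1 g) := by
        intro χ
        rw [mul_left_comm, Finset.mul_sum]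
        simp only [mul_assoc]
      simp only [h2]
      rw [← Finset.mul_sum, Finset.sum_comm]
      simp only [← Finset.sum_mul]
      have h3 : ∀ g, ∑ χ ∈ s, c χ * χ.1 g = 0 := fun g => by
        simpa using congrFun hc g
      simp [h3]
    simp only [irrChar_orthonormal (Subtype.prop _) ψ.2] at h1
    simpa [Subtype.ext_iff.symm, hψ] using h1
  exact hli.finite

open scoped Classical in
/-- The coefficients of a class function with respect to the irreducible characters. -/
theorem eq_finsum_irrChar_iff (f : H → ℂ) (hf : ∀ g h, f (h * g * h⁻¹) = f g)
    (c : irrChar H → ℂ) :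
    (∀ g, f g = ∑ᶠ χ, c χ * χ.1 g) ↔
      ∀ χ, c χ = (Fintype.card H : ℂ)⁻¹ * ∑ g, f g * starRingEnd ℂ (χ.1 g) := by
  have : Finite (irrChar H) := irrChar_finite
  have : Fintype (irrChar H) := Fintype.ofFinite _
  simp only [finsum_eq_sum_of_fintype]
  have key : ∀ (c : irrChar H → ℂ) (ψ : irrChar H),
      (Fintype.card H : ℂ)⁻¹ * ∑ g, (∑ χ, c χ * χ.1 g) * starRingEnd ℂ (ψ.1 g) = c ψ := by
    intro c ψ
    have h1 : ∑ χ, c χ * ((Fintype.card H : ℂ)⁻¹ * ∑ g, χ.1 g * starRingEnd ℂ (ψ.1 g)) = c ψ := by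
      simp only [irrChar_orthonormal (Subtype.prop _) ψ.2]
      simp [Subtype.ext_iff.symm]
    rw [← h1]
    simp only [Finset.sum_mul]
    rw [Finset.sum_comm, Finset.mul_sum]
    refine Finset.sum_congr rfl fun χ _ => ?_
    simp only [mul_assoc]
    rw [← Finset.mul_sum, mul_left_comm]
  constructor
  · intro h χ
    simp only [h, key]
  · intro h
    -- Inverses appear because `eq_zero_of_forall_irrChar` pairs with χ itself, not with its
    -- conjugate.
    have h0 : (fun g => f g⁻¹ - ∑ χ, c χ * χ.1 g⁻¹) = 0 := by
      refine eq_zero_of_forall_irrChar _ (fun g h => ?_) fun ψ hψ => ?_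
      · have h1 : (h * g * h⁻¹)⁻¹ = h * g⁻¹ * h⁻¹ := by group
        rw [h1, hf]
        congr 1
        refine Finset.sum_congr rfl fun χ _ => ?_
        obtain ⟨n, ρ, hρ, hχ⟩ := χ.2
        rw [← hχ, char_conj]
      · rw [Fintype.sum_equiv (Equiv.inv H) _ (fun g => (f g - ∑ χ, c χ * χ.1 g)
          * starRingEnd ℂ (ψ g))]
        · have hcard : (Fintype.card H : ℂ)⁻¹ ≠ 0 :=
            inv_ne_zero (Nat.cast_ne_zero.mpr Fintype.card_ne_zero)
          refine (mul_right_inj' hcard).mp ?_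
          simp only [sub_mul, Finset.sum_sub_distrib]
          rw [mul_sub, key c ⟨ψ, hψ⟩, h ⟨ψ, hψ⟩, sub_self, mul_zero]
        · intro g
          obtain ⟨n, ρ, hρ, rfl⟩ := hψ
          simp [conj_character]
    intro g
    have := congrFun h0 g⁻¹
    simp only [inv_inv, Pi.zero_apply] at this
    exact sub_eq_zero.mp this

end

end Representation

/-! ### Galois action on the coefficients β -/

section Beta

/-- With y = gx the character is evaluated at xy⁻¹. Since Σ f(x)ρ(x) is a scalar, the sum over x
splits off and the double sum factors. -/
theorem Representation.sum_correlation_mul_character {H : Type*} [Group H] [Fintype H] {V : Type*}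
    [AddCommGroup V] [Module ℂ V] [FiniteDimensional ℂ V] {ρ : Representation ℂ H V}
    (hρ : ρ.IsIrreducible) (f : H → ℂ) (hf : ∀ g h, f (h * g * h⁻¹) = f g) :
    ∑ g, (∑ x, f x * f (g * x)) * ρ.character g⁻¹
      = (∑ x, f x * ρ.character x) / Module.finrank ℂ V * ∑ y, f y * ρ.character y⁻¹ := by
  have h1 : ∀ y, ∑ x, f x * ρ.character (x * y)
      = (∑ x, f x * ρ.character x) / Module.finrank ℂ V * ρ.character y := by
    intro y
    have h2 := congrArg (fun T => LinearMap.trace ℂ V (T * ρ y)) (sum_smul_eq_smul_one hρ f hf)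
    simp only [Finset.sum_mul, smul_mul_assoc, one_mul, map_sum, map_smul, smul_eq_mul,
      ← map_mul] at h2
    exact h2
  have h3 : ∑ g, (∑ x, f x * f (g * x)) * ρ.character g⁻¹
      = ∑ y, f y * ∑ x, f x * ρ.character (x * y⁻¹) := by
    simp only [Finset.sum_mul, Finset.mul_sum]
    rw [Finset.sum_comm]
    conv_rhs => rw [Finset.sum_comm]
    refine Finset.sum_congr rfl fun x _ => ?_
    refine Fintype.sum_equiv (Equiv.mulRight x) _ _ fun g => ?_
    simp only [Equiv.coe_mulRight, mul_inv_rev, mul_inv_cancel_left]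
    ring
  rw [h3]
  simp only [h1]
  rw [Finset.mul_sum]
  refine Finset.sum_congr rfl fun y _ => ?_
  ring

variable {G : Type u} [Group G]

theorem pairCount_conj (m : ℤ) (h z x : G) :
    pairCount m (x * h * x⁻¹) (x * z * x⁻¹) = pairCount m h z := by
  refine (Nat.card_congr ((MulAut.conj x).toEquiv.subtypeEquiv fun y => ?_)).symm
  change _ ↔ (x * y * x⁻¹) ^ m = _ ∧ (x * h * x⁻¹ * (x * y * x⁻¹)) ^ m = _
  have h1 : x * h * x⁻¹ * (x * y * x⁻¹) = x * (h * y) * x⁻¹ := by group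
  rw [h1, conj_zpow, conj_zpow]
  simp only [mul_left_inj, mul_right_inj]

theorem pairCount_conj_of_commute_left (m : ℤ) {h z x : G} (hx : x * h = h * x) :
    pairCount m h (x * z * x⁻¹) = pairCount m h z := by
  have h1 := pairCount_conj m h z x
  rwa [hx, mul_inv_cancel_right] at h1

theorem pairCount_conj_of_commute_right (m : ℤ) {h z x : G} (hx : x * z = z * x) :
    pairCount m (x * h * x⁻¹) z = pairCount m h z := by
  have h1 := pairCount_conj m h z x
  rwa [hx, mul_inv_cancel_right] at h1

variable [Fintype G]

open scoped Classical in
/-- The coefficient of `χ` in the class function `g ↦ pairCount m g w` on `C_G(z)`. -/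
noncomputable def pairCountCoeff (m : ℤ) (z w : G)
    (χ : Subgroup.centralizer ({z} : Set G) → ℂ) : ℂ :=
  (Fintype.card (Subgroup.centralizer ({z} : Set G)) : ℂ)⁻¹ *
    ∑ g : Subgroup.centralizer ({z} : Set G), (pairCount m (g : G) w : ℂ) * starRingEnd ℂ (χ g)

theorem pairCountCoeff_self (m : ℤ) (z : G) (χ : Subgroup.centralizer ({z} : Set G) → ℂ) :
    pairCountCoeff m z z χ = betaCoeff m z χ := rfl

-- Each x with x^m = w commutes with w, hence with z by `hw`. So the count takes place inside
-- C_G(z), where it is the autocorrelation of the class function [x^m = w].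
open scoped Classical in
theorem pairCountCoeff_eq_mul (m : ℤ) {z w : G} (hw : ∀ x : G, x * w = w * x ↔ x * z = z * x)
    {n : ℕ} {ρ : Representation ℂ (Subgroup.centralizer ({z} : Set G)) (Fin n → ℂ)}
    (hρ : ρ.IsIrreducible) :
    pairCountCoeff m z w ρ.character
      = (Fintype.card (Subgroup.centralizer ({z} : Set G)) : ℂ)⁻¹ *
        ((∑ x : Subgroup.centralizer ({z} : Set G),
            (if (x : G) ^ m = w then 1 else 0) * ρ.character x) / n *
          ∑ x : Subgroup.centralizer ({z} : Set G),
            (if (x : G) ^ m = w then 1 else 0) * ρ.character x⁻¹) := by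
  have hmem : ∀ x : G, x ∈ Subgroup.centralizer ({z} : Set G) ↔ x * z = z * x := fun x => by
    rw [Subgroup.mem_centralizer_singleton_iff]
  have h1 := Representation.sum_correlation_mul_character hρ
    (fun x : Subgroup.centralizer ({z} : Set G) => if (x : G) ^ m = w then (1 : ℂ) else 0) ?_
  · rw [Module.finrank_fin_fun] at h1
    rw [← h1, pairCountCoeff]
    congr 1
    refine Finset.sum_congr rfl fun g _ => ?_
    rw [Representation.conj_character]
    congr 1
    have h2 : ∀ x : Subgroup.centralizer ({z} : Set G),
        (if (x : G) ^ m = w then (1 : ℂ) else 0) * (if ((g * x : Subgroup.centralizer ({z} : Set G))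
          : G) ^ m = w then (1 : ℂ) else 0)
        = if (x : G) ^ m = w ∧ ((g : G) * x) ^ m = w then 1 else 0 := fun x => by
      rw [Subgroup.coe_mul, ite_and, ite_mul, one_mul, zero_mul]
    simp only [h2]
    rw [Finset.sum_boole, ← Fintype.card_subtype, ← Nat.card_eq_fintype_card, pairCount]
    congr 1
    refine Nat.card_congr
      { toFun := fun x => ⟨⟨x.1, ?_⟩, x.2⟩
        invFun := fun x => ⟨x.1.1, x.2⟩
        left_inv := fun x => rfl
        right_inv := fun x => rfl }
    rw [hmem, ← hw]
    have h4 := (Commute.refl x.1).zpow_right m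
    rwa [x.2.1] at h4
  · intro g h
    have h3 : (h : G) * w = w * h := (hw h).mpr ((hmem _).mp h.2)
    simp only [Subgroup.coe_mul, Subgroup.coe_inv, conj_zpow]
    refine if_congr ?_ rfl rfl
    rw [mul_inv_eq_iff_eq_mul, ← h3, mul_right_inj]

/-- Applied to the definition, σ would only twist the character. In the product form the twist χ(x)
↦ χ(x^k) is absorbed by x ↦ x^k, which carries the solutions of x^m = z to those of x^m = z^k. -/
theorem map_betaCoeff (m : ℤ) (z : G) (σ : ℂ →+* ℂ) (k : ℕ) (hk : k ≠ 0)
    (hkG : k.Coprime (Fintype.card G)) (hσ : ∀ ω : ℂ, ω ^ Fintype.card G = 1 → σ ω = ω ^ k)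
    {χ : Subgroup.centralizer ({z} : Set G) → ℂ}
    (hχ : χ ∈ irrChar (Subgroup.centralizer ({z} : Set G))) :
    σ (betaCoeff m z χ) = pairCountCoeff m z (z ^ k) χ := by
  classical
  obtain ⟨n, ρ, hρ, rfl⟩ := hχ
  have hcard : ∀ h : Subgroup.centralizer ({z} : Set G), h ^ Fintype.card G = 1 := fun h =>
    Subtype.ext (by rw [Subgroup.coe_pow, pow_card_eq_one, Subgroup.coe_one])
  have hmap := ρ.map_character σ _ k Fintype.card_pos hcard hk hσ
  have hG : (Nat.card G).Coprime k := by rw [Nat.card_eq_fintype_card]; exact hkG.symm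
  have hH : (Nat.card (Subgroup.centralizer ({z} : Set G))).Coprime k :=
    hG.coprime_dvd_left (Subgroup.card_subgroup_dvd_card _)
  have hpow : ∀ x : Subgroup.centralizer ({z} : Set G),
      ((x ^ k : Subgroup.centralizer ({z} : Set G)) : G) ^ m = z ^ k ↔ (x : G) ^ m = z := by
    intro x
    rw [Subgroup.coe_pow, ← zpow_natCast, zpow_comm, zpow_natCast]
    exact (powCoprime hG).injective.eq_iff
  rw [← pairCountCoeff_self, pairCountCoeff_eq_mul m (fun _ => Iff.rfl) hρ,
    pairCountCoeff_eq_mul m (DrinfeldDouble.commute_pow_iff hkG · z) hρ]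
  simp only [map_mul, map_inv₀, map_natCast, map_div₀, map_sum, apply_ite σ, map_one, map_zero,
    hmap]
  have h1 : ∑ x : Subgroup.centralizer ({z} : Set G),
        (if (x : G) ^ m = z then 1 else 0) * ρ.character (x ^ k)
      = ∑ x : Subgroup.centralizer ({z} : Set G),
        (if (x : G) ^ m = z ^ k then 1 else 0) * ρ.character x := by
    refine Fintype.sum_equiv (powCoprime hH) _ _ fun x => ?_
    rw [powCoprime_apply, if_congr (hpow x) rfl rfl]
  have h2 : ∑ x : Subgroup.centralizer ({z} : Set G),
        (if (x : G) ^ m = z then 1 else 0) * ρ.character (x⁻¹ ^ k)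
      = ∑ x : Subgroup.centralizer ({z} : Set G),
        (if (x : G) ^ m = z ^ k then 1 else 0) * ρ.character x⁻¹ := by
    refine Fintype.sum_equiv (powCoprime hH) _ _ fun x => ?_
    rw [powCoprime_apply, if_congr (hpow x) rfl rfl, inv_pow]
  rw [h1, h2]

theorem isIntegral_betaCoeff (m : ℤ) (z : G) {χ : Subgroup.centralizer ({z} : Set G) → ℂ}
    (hχ : χ ∈ irrChar (Subgroup.centralizer ({z} : Set G))) :
    IsIntegral ℚ (betaCoeff m z χ) := by
  classical
  obtain ⟨n, ρ, hρ, rfl⟩ := hχ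
  refine IsIntegral.mul ?_ (IsIntegral.sum _ fun h _ => (isIntegral_natCast _).mul ?_)
  · have := isIntegral_algebraMap (R := ℚ) (A := ℂ)
      (x := (Fintype.card (Subgroup.centralizer ({z} : Set G)) : ℚ)⁻¹)
    rwa [map_inv₀, map_natCast] at this
  · rw [Representation.conj_character]
    exact ρ.isIntegral_character _

omit [Fintype G] in
theorem gammaFun_conj (m : ℤ) (z : G) (g h : Subgroup.centralizer ({z} : Set G)) :
    gammaFun m z (h * g * h⁻¹) = gammaFun m z g := by
  change (pairCount m (((h * g * h⁻¹ : Subgroup.centralizer ({z} : Set G))) : G) z : ℂ)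
    = pairCount m (g : G) z
  rw [Subgroup.coe_mul, Subgroup.coe_mul, Subgroup.coe_inv, pairCount_conj_of_commute_right]
  exact Subgroup.mem_centralizer_singleton_iff.mp h.2

/-- Rationality of the coefficients `β` in terms of power maps. -/
theorem forall_betaCoeff_mem_iff (m : ℤ) (K : IntermediateField ℚ ℂ) :
    (∀ (z : G), ∀ χ ∈ irrChar (Subgroup.centralizer ({z} : Set G)), betaCoeff m z χ ∈ K) ↔
      ∀ (σ : ℂ →ₐ[K] ℂ) (k : ℕ), k ≠ 0 → k.Coprime (Fintype.card G) →
        (∀ ω : ℂ, ω ^ Fintype.card G = 1 → σ ω = ω ^ k) →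
        ∀ h z : G, h * z = z * h → pairCount m h (z ^ k) = pairCount m h z := by
  classical
  constructor
  · intro hβ σ k hk hkG hσ h z hz
    -- Since σ fixes the β's, N(·,z^k) and N(·,z) have the same coefficients on C_G(z), hence
    -- coincide there.
    have hfun := (Representation.eq_finsum_irrChar_iff
      (fun g : Subgroup.centralizer ({z} : Set G) => (pairCount m (g : G) (z ^ k) : ℂ)) ?_
      (fun χ => betaCoeff m z χ.1)).mpr ?_
    · have hfun' := (Representation.eq_finsum_irrChar_iff (gammaFun m z) (gammaFun_conj m z)
        (fun χ => betaCoeff m z χ.1)).mpr fun χ => rfl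
      have hh : h ∈ Subgroup.centralizer ({z} : Set G) :=
        Subgroup.mem_centralizer_singleton_iff.mpr hz
      have := (hfun ⟨h, hh⟩).trans (hfun' ⟨h, hh⟩).symm
      exact Nat.cast_injective (R := ℂ) this
    · intro g x
      rw [Subgroup.coe_mul, Subgroup.coe_mul, Subgroup.coe_inv, pairCount_conj_of_commute_right]
      exact Commute.pow_right (Subgroup.mem_centralizer_singleton_iff.mp x.2) k
    · intro χ
      have h1 := map_betaCoeff m z σ k hk hkG hσ χ.2
      have h2 : σ (betaCoeff m z χ.1) = betaCoeff m z χ.1 :=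
        σ.commutes ⟨betaCoeff m z χ.1, hβ z χ.1 χ.2⟩
      exact h2.symm.trans h1
  · intro H z χ hχ
    refine mem_of_forall_algHom_fixed K _ (isIntegral_betaCoeff m z hχ) fun σ => ?_
    obtain ⟨k, hk, hkG, hσ⟩ := exists_coprime_pow_of_ringHom (Fintype.card G) Fintype.card_pos
      (σ : ℂ →+* ℂ)
    have h1 := map_betaCoeff m z (σ : ℂ →+* ℂ) k hk hkG hσ hχ
    refine h1.trans ?_
    rw [← pairCountCoeff_self, pairCountCoeff, pairCountCoeff]
    congr 1
    refine Finset.sum_congr rfl fun g _ => ?_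
    rw [H σ k hk hkG hσ g z (Subgroup.mem_centralizer_singleton_iff.mp g.2)]

end Beta

/-! ### Simplicity and characters of the associated modules -/

namespace AssociatedModule

open DrinfeldDouble

variable {G : Type u} [Group G] [Fintype G] (g : G) {W : Type*} [AddCommGroup W] [Module ℂ W]
  (ρ : Representation ℂ (Subgroup.centralizer ({g} : Set G)) W)

omit [Fintype G] in
theorem mem_centralizer_iff_conj {x : G} :
    x ∈ Subgroup.centralizer ({g} : Set G) ↔ g = x * g * x⁻¹ := by
  rw [Subgroup.mem_centralizer_singleton_iff, eq_mul_inv_iff_mul_eq, eq_comm]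

open scoped Classical in
theorem e_smul_apply (h t : G) (f : AssociatedModule g ρ) (x : G) :
    (e h t • f).1 x = if h = x * g * x⁻¹ then f.1 (t⁻¹ * x) else 0 := by
  have h1 : e h t • f = actE g ρ h t f := by
    change actHom g ρ (e h t) f = _
    exact LinearMap.congr_fun (lift_e (actE g ρ) h t) f
  rw [h1, actE_apply]

open scoped Classical in
/-- The function supported on `C_G(g)` with the value `w` at `1`. -/
noncomputable def ofFiber : W →ₗ[ℂ] AssociatedModule g ρ where
  toFun w := ⟨fun x => if hx : x ∈ Subgroup.centralizer ({g} : Set G) then ρ ⟨x, hx⟩⁻¹ w else 0, by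
    intro x c
    dsimp only
    by_cases hx : x ∈ Subgroup.centralizer ({g} : Set G)
    · rw [dif_pos hx, dif_pos (mul_mem hx c.2), ← Module.End.mul_apply, ← map_mul, ← mul_inv_rev]
      rfl
    · rw [dif_neg hx, dif_neg (fun h => hx ((mul_mem_cancel_right c.2).mp h)), map_zero]⟩
  map_add' a b := by
    apply Subtype.ext
    funext x
    change (if hx : x ∈ Subgroup.centralizer ({g} : Set G) then ρ ⟨x, hx⟩⁻¹ (a + b) else 0)
      = (if hx : x ∈ Subgroup.centralizer ({g} : Set G) then ρ ⟨x, hx⟩⁻¹ (a) else 0)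
        + (if hx : x ∈ Subgroup.centralizer ({g} : Set G) then ρ ⟨x, hx⟩⁻¹ (b) else 0)
    split_ifs <;> simp
  map_smul' r a := by
    apply Subtype.ext
    funext x
    change (if hx : x ∈ Subgroup.centralizer ({g} : Set G) then ρ ⟨x, hx⟩⁻¹ (r • a) else 0)
      = r • (if hx : x ∈ Subgroup.centralizer ({g} : Set G) then ρ ⟨x, hx⟩⁻¹ (a) else 0)
    split_ifs <;> simp

omit [Fintype G] in
open scoped Classical in
theorem ofFiber_apply (w : W) (x : G) : (ofFiber g ρ w).1 x =
    if hx : x ∈ Subgroup.centralizer ({g} : Set G) then ρ ⟨x, hx⟩⁻¹ w else 0 := rfl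

omit [Fintype G] in
theorem ofFiber_apply_one (w : W) : (ofFiber g ρ w).1 1 = w := by
  rw [ofFiber_apply, dif_pos (one_mem _)]
  have : (⟨1, one_mem _⟩ : Subgroup.centralizer ({g} : Set G)) = 1 := rfl
  rw [this, inv_one, map_one, Module.End.one_apply]

omit [Fintype G] in
theorem ofFiber_injective : Function.Injective (ofFiber g ρ) := fun w w' h => by
  rw [← ofFiber_apply_one g ρ w, h, ofFiber_apply_one]

/-- The element δ_g projects onto functions supported on C_G(g), and equivariance determines these
by their value at 1. -/
theorem e_smul_eq_ofFiber (t : G) (f : AssociatedModule g ρ) :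
    e g t • f = ofFiber g ρ (f.1 t⁻¹) := by
  apply Subtype.ext
  funext x
  rw [e_smul_apply, ofFiber_apply]
  by_cases hx : x ∈ Subgroup.centralizer ({g} : Set G)
  · rw [dif_pos hx, if_pos ((mem_centralizer_iff_conj g).mp hx)]
    exact f.2 t⁻¹ ⟨x, hx⟩
  · rw [dif_neg hx, if_neg (fun h => hx ((mem_centralizer_iff_conj g).mpr h))]

omit [Fintype G] in
theorem ofFiber_apply_centralizer (c : Subgroup.centralizer ({g} : Set G)) (w : W) :
    (ofFiber g ρ w).1 (c : G)⁻¹ = ρ c w := by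
  rw [ofFiber_apply, dif_pos (inv_mem c.2)]
  congr 2
  exact inv_inv c

/-- The term for x is the restriction of f to the coset x C_G(g), so each coset is counted |C_G(g)|
times. This shows that the fibre generates the module. -/
theorem sum_e_smul_ofFiber (f : AssociatedModule g ρ) :
    ∑ x : G, e (x * g * x⁻¹) x • ofFiber g ρ (f.1 x)
      = (Nat.card (Subgroup.centralizer ({g} : Set G)) : ℂ) • f := by
  classical
  apply Subtype.ext
  funext y
  have h0 : ∀ F : G → AssociatedModule g ρ, (∑ i, F i).1 = ∑ i, (F i).1 :=
    fun F => map_sum (associatedSubmodule g ρ).subtype F _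
  rw [h0, Finset.sum_apply]
  have h1 : ∀ x : G, (e (x * g * x⁻¹) x • ofFiber g ρ (f.1 x)).1 y
      = if y⁻¹ * x ∈ Subgroup.centralizer ({g} : Set G) then f.1 y else 0 := by
    intro x
    rw [e_smul_apply, ofFiber_apply]
    have h2 : y⁻¹ * x ∈ Subgroup.centralizer ({g} : Set G) ↔ x * g * x⁻¹ = y * g * y⁻¹ := by
      rw [mem_centralizer_iff_conj]
      constructor
      · intro h
        conv_rhs => rw [h]
        group
      · intro h
        rw [show y⁻¹ * x * g * (y⁻¹ * x)⁻¹ = y⁻¹ * (x * g * x⁻¹) * y by group, h]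
        group
    rw [if_congr h2.symm rfl rfl]
    by_cases hx : y⁻¹ * x ∈ Subgroup.centralizer ({g} : Set G)
    · have hx' : x⁻¹ * y ∈ Subgroup.centralizer ({g} : Set G) := by
        rw [← inv_mem_iff]; simpa using hx
      rw [if_pos hx, if_pos hx, dif_pos hx']
      have h3 := f.2 x ⟨x⁻¹ * y, hx'⟩
      rw [mul_inv_cancel_left] at h3
      exact h3.symm
    · rw [if_neg hx, if_neg hx]
  simp only [h1]
  have h2 : ∑ x, (if y⁻¹ * x ∈ Subgroup.centralizer ({g} : Set G) then f.1 y else 0)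
      = ∑ x, if x ∈ Subgroup.centralizer ({g} : Set G) then f.1 y else 0 :=
    Fintype.sum_equiv (Equiv.mulLeft y⁻¹) _ _ fun x => rfl
  rw [h2, ← Finset.sum_filter, Finset.sum_const, ← Fintype.card_subtype,
    ← Nat.card_eq_fintype_card, ← Nat.cast_smul_eq_nsmul ℂ]
  rfl

/-- A submodule A meets the fibre in a subrepresentation of W. If that is zero, every value of every
f in A vanishes; if it is W, then A contains the fibre and thus everything. -/
theorem isSimpleModule (hρ : ρ.IsIrreducible) :
    IsSimpleModule (DrinfeldDouble G) (AssociatedModule g ρ) := by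
  have hW : Nontrivial W := by
    rw [Representation.irreducible_iff_isSimpleModule_asModule] at hρ
    exact IsSimpleModule.nontrivial
      (MonoidAlgebra ℂ (Subgroup.centralizer ({g} : Set G))) ρ.asModule
  have hnt : Nontrivial (AssociatedModule g ρ) := (ofFiber_injective g ρ).nontrivial
  rw [isSimpleModule_iff]
  refine { eq_bot_or_eq_top := fun A => ?_ }
  let P : Subrepresentation ρ :=
    { toSubmodule := (A.restrictScalars ℂ).comap (ofFiber g ρ)
      apply_mem_toSubmodule := fun c w hw => by
        change ofFiber g ρ (ρ c w) ∈ A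
        rw [← ofFiber_apply_centralizer, ← e_smul_eq_ofFiber]
        exact A.smul_mem _ hw }
  have hP : ∀ w, w ∈ P.toSubmodule ↔ ofFiber g ρ w ∈ A := fun w => Iff.rfl
  rcases hρ.eq_bot_or_eq_top P with h | h
  · left
    rw [eq_bot_iff]
    intro f hf
    apply Subtype.ext
    funext x
    have h1 : f.1 x ∈ P.toSubmodule := by
      rw [hP]
      have := A.smul_mem (e g x⁻¹) hf
      rwa [e_smul_eq_ofFiber, inv_inv] at this
    rw [h] at h1
    exact h1
  · right
    rw [eq_top_iff]
    intro f _
    have h1 : (Nat.card (Subgroup.centralizer ({g} : Set G)) : ℂ) • f ∈ A := by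
      rw [← sum_e_smul_ofFiber]
      refine Submodule.sum_mem _ fun x _ => A.smul_mem _ ?_
      rw [← hP, h]
      trivial
    have hc : (Nat.card (Subgroup.centralizer ({g} : Set G)) : ℂ) ≠ 0 :=
      Nat.cast_ne_zero.mpr Nat.card_pos.ne'
    have h2 := Submodule.smul_of_tower_mem A
      (Nat.card (Subgroup.centralizer ({g} : Set G)) : ℂ)⁻¹ h1
    rwa [smul_smul, inv_mul_cancel₀ hc, one_smul] at h2

instance [FiniteDimensional ℂ W] : FiniteDimensional ℂ (AssociatedModule g ρ) :=
  inferInstanceAs (FiniteDimensional ℂ (associatedSubmodule g ρ))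

theorem moduleTrace_e_of_not_isConj {h : G} (hh : ¬ ∃ x, h = x * g * x⁻¹) (z : G) :
    moduleTrace (AssociatedModule g ρ) (e h z) = 0 := by
  classical
  have h1 : Algebra.lsmul ℂ ℂ (AssociatedModule g ρ) (e h z) = 0 := by
    apply LinearMap.ext
    intro f
    apply Subtype.ext
    funext x
    rw [Algebra.lsmul_coe, e_smul_apply, if_neg (fun hx => hh ⟨x, hx⟩)]
    rfl
  change LinearMap.trace ℂ _ (Algebra.lsmul ℂ ℂ (AssociatedModule g ρ) (e h z)) = 0
  rw [h1, map_zero]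

/-- The action factors through W as evaluation at 1, then ρ(c), then the embedding of the fibre;
cyclicity of the trace leaves ρ(c). -/
theorem moduleTrace_e [FiniteDimensional ℂ W] (c : Subgroup.centralizer ({g} : Set G)) :
    moduleTrace (AssociatedModule g ρ) (e g c) = ρ.character c := by
  let ev : AssociatedModule g ρ →ₗ[ℂ] W :=
    (LinearMap.proj (1 : G)).comp (associatedSubmodule g ρ).subtype
  have h1 : Algebra.lsmul ℂ ℂ (AssociatedModule g ρ) (e g c)
      = ofFiber g ρ ∘ₗ (ρ c ∘ₗ ev) := by
    apply LinearMap.ext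
    intro f
    change e g (c : G) • f = _
    rw [e_smul_eq_ofFiber, LinearMap.comp_apply, LinearMap.comp_apply]
    congr 1
    have := f.2 1 c⁻¹
    rw [one_mul, inv_inv] at this
    exact this
  change LinearMap.trace ℂ _ (Algebra.lsmul ℂ ℂ (AssociatedModule g ρ) (e g c)) = _
  rw [h1, LinearMap.trace_comp_comm', Representation.character]
  congr 1
  apply LinearMap.ext
  intro w
  change ρ c ((ofFiber g ρ w).1 1) = _
  rw [ofFiber_apply_one]

open scoped Classical in
/-- A sum over `G × G` against the character of an associated module reduces to one over the
centralizer. -/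
theorem sum_mul_moduleTrace [FiniteDimensional ℂ W] (Φ : G → G → ℂ)
    (hΦ : ∀ h z x, Φ (x * h * x⁻¹) (x * z * x⁻¹) = Φ h z) :
    ∑ h, ∑ z, Φ h z * moduleTrace (AssociatedModule g ρ) (e h z)
      = (Fintype.card {h : G // ∃ x, h = x * g * x⁻¹} : ℂ) *
        ∑ z : Subgroup.centralizer ({g} : Set G), Φ g z * ρ.character z := by
  have h1 : ∑ z, Φ g z * moduleTrace (AssociatedModule g ρ) (e g z)
      = ∑ z : Subgroup.centralizer ({g} : Set G), Φ g z * ρ.character z := by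
    have h3 : ∀ z, Φ g z * moduleTrace (AssociatedModule g ρ) (e g z)
        = if z ∈ Subgroup.centralizer ({g} : Set G) then
          Φ g z * moduleTrace (AssociatedModule g ρ) (e g z) else 0 := by
      intro z
      split_ifs with hz
      · rfl
      · rw [moduleTrace_e_of_ne, mul_zero]
        exact fun h4 => hz (Subgroup.mem_centralizer_singleton_iff.mpr h4.symm)
    rw [Finset.sum_congr rfl fun z _ => h3 z, ← Finset.sum_filter,
      Finset.sum_subtype (p := (· ∈ Subgroup.centralizer ({g} : Set G))) _ (by simp)]
    exact Finset.sum_congr rfl fun z _ => by rw [moduleTrace_e]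
  have h2 : ∀ h, ∑ z, Φ h z * moduleTrace (AssociatedModule g ρ) (e h z)
      = if ∃ x, h = x * g * x⁻¹ then
        ∑ z, Φ g z * moduleTrace (AssociatedModule g ρ) (e g z) else 0 := by
    intro h
    split_ifs with hh
    · obtain ⟨x, rfl⟩ := hh
      refine (Fintype.sum_equiv (MulAut.conj x).toEquiv _ _ fun z => ?_).symm
      change _ = Φ (x * g * x⁻¹) (x * z * x⁻¹) * moduleTrace _ (e (x * g * x⁻¹) (x * z * x⁻¹))
      rw [hΦ, moduleTrace_e_conj]
    · exact Finset.sum_eq_zero fun z _ => by rw [moduleTrace_e_of_not_isConj g ρ hh, mul_zero]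
  rw [Finset.sum_congr rfl fun h _ => h2 h, ← Finset.sum_filter, Finset.sum_const, nsmul_eq_mul, Fintype.card_subtype, h1]

end AssociatedModule

/-! ### Rationality of indicators and the main theorem -/

open DrinfeldDouble

namespace DrinfeldDouble

variable (G : Type u) [Group G] [Fintype G]

instance : Module.Finite ℂ (DrinfeldDouble G) :=
  inferInstanceAs (Module.Finite ℂ (G × G →₀ ℂ))

variable {G}

theorem finiteDimensional_of_isSimpleModule (V : Type*) [AddCommGroup V] [Module ℂ V]
    [Module (DrinfeldDouble G) V] [IsScalarTower ℂ (DrinfeldDouble G) V]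
    [IsSimpleModule (DrinfeldDouble G) V] : FiniteDimensional ℂ V := by
  have : Nontrivial V := IsSimpleModule.nontrivial (DrinfeldDouble G) V
  obtain ⟨v, hv⟩ := exists_ne (0 : V)
  have h := IsSimpleModule.toSpanSingleton_surjective (DrinfeldDouble G) hv
  exact Module.Finite.of_surjective
    ((LinearMap.toSpanSingleton (DrinfeldDouble G) V v).restrictScalars ℂ) h

/-- Holds for every finite-dimensional module, so no classification of the simple ones is needed. -/
theorem fsIndicator_mem_of_forall_pairCount (m : ℤ) (K : IntermediateField ℚ ℂ)
    (H : ∀ (σ : ℂ →ₐ[K] ℂ) (k : ℕ), k ≠ 0 → k.Coprime (Fintype.card G) →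
        (∀ ω : ℂ, ω ^ Fintype.card G = 1 → σ ω = ω ^ k) →
        ∀ h z : G, h * z = z * h → pairCount m h (z ^ k) = pairCount m h z)
    (V : Type*) [AddCommGroup V] [Module ℂ V] [Module (DrinfeldDouble G) V]
    [IsScalarTower ℂ (DrinfeldDouble G) V] [FiniteDimensional ℂ V] :
    fsIndicator G m V ∈ K := by
  refine mem_of_forall_algHom_fixed K _ (isIntegral_fsIndicator V m) fun σ => ?_
  obtain ⟨k, hk, hkG, hσ⟩ := exists_coprime_pow_of_ringHom (Fintype.card G) Fintype.card_pos
    (σ : ℂ →+* ℂ)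
  exact map_fsIndicator_eq_self V m (σ : ℂ →+* ℂ) k hk hkG hσ (H σ k hk hkG hσ)

theorem pairCount_pow_eq_of_fsIndicator_mem (m : ℤ) (K : IntermediateField ℚ ℂ)
    (hν : ∀ (g : G) (n : ℕ)
      (ρ : Representation ℂ (Subgroup.centralizer ({g} : Set G)) (Fin n → ℂ)),
      ρ.IsIrreducible → fsIndicator G m (AssociatedModule g ρ) ∈ K)
    (σ : ℂ →ₐ[K] ℂ) (k : ℕ) (hk : k ≠ 0) (hkG : k.Coprime (Fintype.card G))
    (hσ : ∀ ω : ℂ, ω ^ Fintype.card G = 1 → σ ω = ω ^ k) (h z : G) (hz : h * z = z * h) :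
    pairCount m h (z ^ k) = pairCount m h z := by
  classical
  obtain ⟨l, hl⟩ : ∃ l : ℕ, ∀ x : G, (x ^ k) ^ l = x := by
    -- By Euler's theorem this is an inverse of k modulo |G|.
    refine ⟨k ^ ((Fintype.card G).totient - 1), fun x => ?_⟩
    have h1 : 0 < (Fintype.card G).totient := Nat.totient_pos.mpr Fintype.card_pos
    rw [← pow_mul, ← pow_succ', Nat.sub_add_cancel h1]
    have h2 := (Nat.ModEq.pow_totient hkG).of_dvd (orderOf_dvd_card (x := x))
    rw [pow_eq_pow_iff_modEq.mpr h2, pow_one]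
  have hG : (Nat.card G).Coprime k := by rw [Nat.card_eq_fintype_card]; exact hkG.symm
  have hcard : (Fintype.card G : ℂ)⁻¹ ≠ 0 :=
    inv_ne_zero (Nat.cast_ne_zero.mpr Fintype.card_ne_zero)
  -- For fixed h this is a class function on C_G(h); invariance of the indicators under σ makes it
  -- orthogonal to all irreducible characters.
  have key : (fun w : Subgroup.centralizer ({h} : Set G) =>
      ((pairCount m h ((w : G) ^ l) : ℂ) - pairCount m h (w : G))) = 0 := by
    refine Representation.eq_zero_of_forall_irrChar _ (fun w c => ?_) fun χ hχ => ?_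
    · have hc := Subgroup.mem_centralizer_singleton_iff.mp c.2
      rw [Subgroup.coe_mul, Subgroup.coe_mul, Subgroup.coe_inv, conj_pow,
        pairCount_conj_of_commute_left m hc, pairCount_conj_of_commute_left m hc]
    · obtain ⟨n, ρ, hρ, rfl⟩ := hχ
      have h1 : σ (fsIndicator G m (AssociatedModule h ρ)) = fsIndicator G m (AssociatedModule h ρ) :=
        σ.commutes ⟨_, hν h n ρ hρ⟩
      have h2 := map_fsIndicator (AssociatedModule h ρ) m (σ : ℂ →+* ℂ) k hk hkG hσ
      have h3 := (h2.symm.trans h1).trans (fsIndicator_eq_sum _ m)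
      have h4 := mul_left_cancel₀ hcard h3
      -- The substitution x ↦ x^k moves the exponent from the trace to the count, where it becomes
      -- l.
      have h5 : ∀ y : G, ∑ x : G, (pairCount m y x : ℂ)
            * moduleTrace (AssociatedModule h ρ) (e y (x ^ k))
          = ∑ x : G, (pairCount m y (x ^ l) : ℂ) * moduleTrace (AssociatedModule h ρ) (e y x) := by
        intro y
        refine Fintype.sum_equiv (powCoprime hG) _ _ fun x => ?_
        rw [powCoprime_apply, hl]
      rw [Finset.sum_congr rfl fun y _ => h5 y, ← sub_eq_zero, ← Finset.sum_sub_distrib] at h4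
      simp only [← Finset.sum_sub_distrib, ← sub_mul] at h4
      rw [AssociatedModule.sum_mul_moduleTrace h ρ
        (fun y x => (pairCount m y (x ^ l) : ℂ) - pairCount m y x)] at h4
      · refine (mul_eq_zero.mp h4).resolve_left (Nat.cast_ne_zero.mpr ?_)
        have : Nonempty {y : G // ∃ x, y = x * h * x⁻¹} := ⟨⟨h, 1, by group⟩⟩
        exact Fintype.card_ne_zero
      · intro y x c
        rw [conj_pow, pairCount_conj, pairCount_conj]
  have hzk : z ^ k ∈ Subgroup.centralizer ({h} : Set G) :=
    Subgroup.mem_centralizer_singleton_iff.mpr (Commute.pow_right hz k).symm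
  -- At w = z^k the term w^l is z.
  have h6 := congrFun key ⟨z ^ k, hzk⟩
  simp only [hl, Pi.zero_apply, sub_eq_zero, Nat.cast_inj] at h6
  exact h6.symm

end DrinfeldDouble

theorem mainTheorem5 {G : Type u} [Group G] [Fintype G] (m : ℤ) (d : ℕ) (hd : 0 < d) :
    -- the numbers `betaCoeff m z χ` are the unique coefficients of `γ_m^z` in terms of `Irr(C_G(z))`
    (∀ (z : G) (c : irrChar (Subgroup.centralizer ({z} : Set G)) → ℂ),
      (∀ g : Subgroup.centralizer ({z} : Set G), gammaFun m z g = ∑ᶠ χ, c χ * χ.1 g) ↔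
        ∀ χ, c χ = betaCoeff m z χ.1) ∧
    -- the criterion for the indicators `ν_m(g, η)`
    ((∀ (g : G) (n : ℕ) (ρ : Representation ℂ (Subgroup.centralizer ({g} : Set G)) (Fin n → ℂ)),
        ρ.IsIrreducible → fsIndicator G m (AssociatedModule g ρ) ∈ cyclotomicSubfield d) ↔
      ∀ (z : G), ∀ χ ∈ irrChar (Subgroup.centralizer ({z} : Set G)),
        betaCoeff m z χ ∈ cyclotomicSubfield d) ∧
    -- the criterion for the indicators of all simple modules over the Drinfeld double
    ((∀ (V : Type u) [AddCommGroup V] [Module ℂ V] [Module (DrinfeldDouble G) V]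
        [IsScalarTower ℂ (DrinfeldDouble G) V], IsSimpleModule (DrinfeldDouble G) V →
          fsIndicator G m V ∈ cyclotomicSubfield d) ↔
      ∀ (z : G), ∀ χ ∈ irrChar (Subgroup.centralizer ({z} : Set G)),
        betaCoeff m z χ ∈ cyclotomicSubfield d) := by

  refine ⟨fun z c => ?_, ?_, ?_⟩
  · classical
    refine (Representation.eq_finsum_irrChar_iff (gammaFun m z) (gammaFun_conj m z) c).trans ?_
    exact Iff.rfl
  · rw [forall_betaCoeff_mem_iff]
    exact ⟨pairCount_pow_eq_of_fsIndicator_mem m _, fun H g n ρ _ =>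
      fsIndicator_mem_of_forall_pairCount m _ H _⟩
  · rw [forall_betaCoeff_mem_iff]
    -- The associated modules are among the simple ones, and their indicators already force the
    -- invariance of N.
    refine ⟨fun H => pairCount_pow_eq_of_fsIndicator_mem m _ fun g n ρ hρ =>
      H _ (AssociatedModule.isSimpleModule g ρ hρ), fun H V _ _ _ _ hV => ?_⟩
    have := finiteDimensional_of_isSimpleModule (G := G) V
    exact fsIndicator_mem_of_forall_pairCount m _ H V
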